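/- For a partition $\lambda$ let $\mathrm{mex}_{2,2}(\lambda)$ be the smallest positive even integer that is not a part of $\lambda$, and let $p_{2,2}(n)$ be the number of partitions $\lambda$ of $n$ with $\mathrm{mex}_{2,2}(\lambda)\equiv 2 \pmod 4$. The rerank of a partition $\lambda$, identified with its Ferrers diagram, is defined as follows. 1. Let $m$ be the largest integer $m\ge 0$ such that $\lambda$ contains the rectangle with $m$ rows and $m+1$ columns, and let $A$ be the sub-diagram of $\lambda$ formed by the cells in the first $m$ rows that lie to the right of the first $m+1$ columns ($A=\emptyset$ if $m=0$). 2. A rim hook is an edgewise connected skew diagram without a $2\times 2$ block of cells, and its arm length is one less than the number of columns it occupies. The rim of a diagram consists of its cells $(i,j)$ such that $(i+1,j+1)$ is not a cell of the diagram. As long as the diagram (starting with $A$) has at least $m+2$ columns, remove from it the longest of the rightmost rim hooks with arm length $m+1$ lying along its rim. Let $R$ be the diagram that is left when there are fewer than $m+2$ columns. 3. Let $(x_1,\dots,x_d\mid y_1,\dots,y_d)$ be the Frobenius representation of $R$, that is, $d$ is the number of cells on the main diagonal of $R$, $x_i$ is the number of cells of row $i$ to the right of $(i,i)$, and $y_i$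 is the number of cells of column $i$ below $(i,i)$ (with $d=0$ if $R=\emptyset$). Put $y_0=m$ and $x_{d+1}=-1$. Then $$\mathrm{rerank}(\lambda)=\max_{0\le i\le d}(y_i-x_{i+1})-1 .$$ For every integer $n\ge 0$, $p_{2,2}(n)$ equals the number of partitions of $n$ with even rerank. -/

import Mathlib

namespace MexRerank

/-! ### Cells, rim hooks and the rim

Cells are pairs `(row, column)`, both counted from `0`. -/

/-- Two cells are adjacent when they share an edge. -/
def cellGraph : SimpleGraph (ℕ × ℕ) where
  Adj c c' := (c.1 = c'.1 ∧ (c.2 + 1 = c'.2 ∨ c'.2 + 1 = c.2)) ∨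
    (c.2 = c'.2 ∧ (c.1 + 1 = c'.1 ∨ c'.1 + 1 = c.1))
  symm := ⟨fun c c' h => by omega⟩
  loopless := ⟨fun c h => by omega⟩

/-- A rim hook (border strip): a skew diagram that is edgewise connected (in particular
nonempty) and contains no `2 × 2` block of cells. -/
def IsRimHook (S : Finset (ℕ × ℕ)) : Prop :=
  (∃ μ ν : YoungDiagram, ν ≤ μ ∧ S = μ.cells \ ν.cells) ∧
  (cellGraph.induce (S : Set (ℕ × ℕ))).Connected ∧
  ∀ i j : ℕ, ¬ ((i, j) ∈ S ∧ (i, j + 1) ∈ S ∧ (i + 1, j) ∈ S ∧ (i + 1, j + 1) ∈ S)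

/-- The arm length of a rim hook: one less than the number of columns it occupies. -/
def armLength (S : Finset (ℕ × ℕ)) : ℕ := (S.image Prod.snd).card - 1

/-- The index of the rightmost column that a set of cells occupies. -/
def lastColumn (S : Finset (ℕ × ℕ)) : ℕ := S.sup Prod.snd

/-- The rim of a diagram: the cells along its south-east border. -/
def rim (μ : YoungDiagram) : Finset (ℕ × ℕ) :=
  μ.cells.filter fun c => (c.1 + 1, c.2 + 1) ∉ μ

/-- `S` is a rim hook with arm length `h` lying along the rim of `μ`. -/
def IsRimHookAlong (μ : YoungDiagram) (h : ℕ) (S : Finset (ℕ × ℕ)) : Prop :=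
  IsRimHook S ∧ armLength S = h ∧ S ⊆ rim μ

/-- `S` is a rightmost one among the rim hooks with arm length `h` lying along the rim of `μ`. -/
def IsRightmostRimHook (μ : YoungDiagram) (h : ℕ) (S : Finset (ℕ × ℕ)) : Prop :=
  IsRimHookAlong μ h S ∧ ∀ T, IsRimHookAlong μ h T → lastColumn T ≤ lastColumn S

/-- `S` is the longest of the rightmost rim hooks with arm length `h` lying along the rim
of `μ`. -/
def IsLongestRightmostRimHook (μ : YoungDiagram) (h : ℕ) (S : Finset (ℕ × ℕ)) : Prop :=
  IsRightmostRimHook μ h S ∧ ∀ T, IsRightmostRimHook μ h T → T.card ≤ S.card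

/-! ### The longest rightmost rim hook exists, is unique, and can be removed -/

/-- All the cells of the rim in the last `h + 1` columns. -/
def rimEnd (μ : YoungDiagram) (h : ℕ) : Finset (ℕ × ℕ) :=
  (rim μ).filter fun c => μ.rowLen 0 ≤ c.2 + h + 1

theorem mem_rim {μ : YoungDiagram} {c : ℕ × ℕ} :
    c ∈ rim μ ↔ c ∈ μ ∧ (c.1 + 1, c.2 + 1) ∉ μ := by
  simp [rim]

theorem mem_rimEnd {μ : YoungDiagram} {h : ℕ} {c : ℕ × ℕ} :
    c ∈ rimEnd μ h ↔ c ∈ μ ∧ (c.1 + 1, c.2 + 1) ∉ μ ∧ μ.rowLen 0 ≤ c.2 + h + 1 := by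
  simp [rimEnd, mem_rim, and_assoc]

theorem snd_lt_of_mem {μ : YoungDiagram} {c : ℕ × ℕ} (hc : c ∈ μ) : c.2 < μ.rowLen 0 :=
  YoungDiagram.mem_iff_lt_rowLen.1 (μ.up_left_mem (Nat.zero_le c.1) le_rfl hc)

/-- The diagram that is left after the removal of `rimEnd μ h`. -/
def sdiffRimEnd (μ : YoungDiagram) (h : ℕ) : YoungDiagram where
  cells := μ.cells \ rimEnd μ h
  isLowerSet := by
    intro c c' hle hc
    simp only [Finset.coe_sdiff, Set.mem_sdiff, Finset.mem_coe, YoungDiagram.mem_cells,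
      mem_rimEnd] at hc ⊢
    have h1 : c'.1 ≤ c.1 := hle.1
    have h2 : c'.2 ≤ c.2 := hle.2
    refine ⟨μ.up_left_mem h1 h2 hc.1, fun hc' => hc.2 ⟨hc.1, fun hm => ?_, by omega⟩⟩
    exact hc'.2.1 (μ.up_left_mem (by omega) (by omega) hm)

theorem corner_mem_rimEnd {μ : YoungDiagram} {h : ℕ} (hw : h < μ.rowLen 0) :
    (0, μ.rowLen 0 - 1) ∈ rimEnd μ h := by
  refine mem_rimEnd.2 ⟨YoungDiagram.mem_iff_lt_rowLen.2 (by omega), fun hm => ?_, ?_⟩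
  · have := snd_lt_of_mem hm
    simp only at this
    omega
  · simp only
    omega

theorem connected_rimEnd {μ : YoungDiagram} {h : ℕ} (hw : h < μ.rowLen 0) :
    (cellGraph.induce (rimEnd μ h : Set (ℕ × ℕ))).Connected := by
  have key : ∀ k : ℕ, ∀ c : ℕ × ℕ, ∀ hc : c ∈ rimEnd μ h, c.1 + (μ.rowLen 0 - c.2) ≤ k →
      (cellGraph.induce (rimEnd μ h : Set (ℕ × ℕ))).Reachable ⟨c, hc⟩
        ⟨_, corner_mem_rimEnd hw⟩ := by
    intro k
    induction k with
    | zero =>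
      intro c hc hk
      have := snd_lt_of_mem (mem_rimEnd.1 hc).1
      omega
    | succ k ih =>
      rintro ⟨i, j⟩ hc hk
      obtain ⟨h1, h2, h3⟩ := mem_rimEnd.1 hc
      have hj := snd_lt_of_mem h1
      simp only at h1 h2 h3 hj hk
      by_cases hr : (i, j + 1) ∈ μ
      · have hm : (i, j + 1) ∈ rimEnd μ h :=
          mem_rimEnd.2 ⟨hr, fun hm => h2 (μ.up_left_mem le_rfl (Nat.le_succ _) hm), by
            simp only
            omega⟩
        refine SimpleGraph.Reachable.trans (SimpleGraph.Adj.reachable ?_) (ih _ hm ?_)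
        · simp [cellGraph]
        · simp only
          omega
      · rcases i with _ | i
        · have : j = μ.rowLen 0 - 1 := by
            rw [YoungDiagram.mem_iff_lt_rowLen] at hr
            omega
          subst this
          exact SimpleGraph.Reachable.refl _
        · have hm : (i, j) ∈ rimEnd μ h :=
            mem_rimEnd.2 ⟨μ.up_left_mem (Nat.le_succ _) le_rfl h1, hr, h3⟩
          refine SimpleGraph.Reachable.trans (SimpleGraph.Adj.reachable ?_) (ih _ hm ?_)
          · simp [cellGraph]
          · simp only
            omega
  refine (SimpleGraph.connected_iff_exists_forall_reachable _).2
    ⟨⟨_, corner_mem_rimEnd hw⟩, fun c => (key _ c.1 c.2 le_rfl).symm⟩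

theorem image_snd_rimEnd {μ : YoungDiagram} {h : ℕ} :
    (rimEnd μ h).image Prod.snd = Finset.Ico (μ.rowLen 0 - (h + 1)) (μ.rowLen 0) := by
  ext j
  simp only [Finset.mem_image, Finset.mem_Ico, mem_rimEnd]
  constructor
  · rintro ⟨c, ⟨h1, -, h3⟩, rfl⟩
    have := snd_lt_of_mem h1
    omega
  · rintro ⟨h1, h2⟩
    have hj : 0 < μ.colLen j :=
      YoungDiagram.mem_iff_lt_colLen.1 (YoungDiagram.mem_iff_lt_rowLen.2 h2)
    refine ⟨(μ.colLen j - 1, j), ⟨YoungDiagram.mem_iff_lt_colLen.2 (by omega), fun hm => ?_, ?_⟩,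
      rfl⟩
    · have := YoungDiagram.mem_iff_lt_colLen.1 (μ.up_left_mem le_rfl (Nat.le_succ j) hm)
      omega
    · simp only
      omega

theorem isRimHookAlong_rimEnd {μ : YoungDiagram} {h : ℕ} (hw : h < μ.rowLen 0) :
    IsRimHookAlong μ h (rimEnd μ h) := by
  refine ⟨⟨⟨μ, sdiffRimEnd μ h, ?_, ?_⟩, connected_rimEnd hw, ?_⟩, ?_, Finset.filter_subset _ _⟩
  · exact YoungDiagram.cells_subset_iff.1 Finset.sdiff_subset
  · ext c
    have := @mem_rimEnd μ h c
    simp only [sdiffRimEnd, Finset.mem_sdiff, YoungDiagram.mem_cells]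
    tauto
  · rintro i j ⟨h1, -, -, h4⟩
    exact (mem_rimEnd.1 h1).2.1 (mem_rimEnd.1 h4).1
  · rw [armLength, image_snd_rimEnd, Nat.card_Ico]
    omega

theorem ordConnected_columns {S : Finset (ℕ × ℕ)}
    (hS : (cellGraph.induce (S : Set (ℕ × ℕ))).Connected) {c c' : ℕ × ℕ} (hc : c ∈ S)
    (hc' : c' ∈ S) {j : ℕ} (h1 : c.2 ≤ j) (h2 : j ≤ c'.2) : j ∈ S.image Prod.snd := by
  by_contra hj
  have hne : ∀ d ∈ S, d.2 ≠ j := fun d hd he => hj (Finset.mem_image.2 ⟨d, hd, he⟩)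
  have key : ∀ d d' : (S : Set (ℕ × ℕ)),
      (cellGraph.induce (S : Set (ℕ × ℕ))).Walk d d' → d.1.2 < j → d'.1.2 < j := by
    intro d d' p
    induction p with
    | nil => exact id
    | @cons u v w hadj p ih =>
      intro hu
      apply ih
      have hv := hne v.1 v.2
      have hadj' : cellGraph.Adj u.1 v.1 := hadj
      simp only [cellGraph] at hadj'
      omega
  obtain ⟨p⟩ := hS.preconnected ⟨c, hc⟩ ⟨c', hc'⟩
  have := key _ _ p (lt_of_le_of_ne h1 (hne c hc))
  simp only at this
  omega

theorem lastColumn_le {μ : YoungDiagram} {h : ℕ} {T : Finset (ℕ × ℕ)}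
    (hT : IsRimHookAlong μ h T) : lastColumn T ≤ μ.rowLen 0 - 1 :=
  Finset.sup_le fun c hc => by
    have := snd_lt_of_mem (mem_rim.1 (hT.2.2 hc)).1
    omega

theorem lastColumn_rimEnd {μ : YoungDiagram} {h : ℕ} (hw : h < μ.rowLen 0) :
    lastColumn (rimEnd μ h) = μ.rowLen 0 - 1 :=
  le_antisymm (lastColumn_le (isRimHookAlong_rimEnd hw))
    (Finset.le_sup (f := Prod.snd) (corner_mem_rimEnd hw))

theorem isRightmostRimHook_rimEnd {μ : YoungDiagram} {h : ℕ} (hw : h < μ.rowLen 0) :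
    IsRightmostRimHook μ h (rimEnd μ h) :=
  ⟨isRimHookAlong_rimEnd hw, fun T hT => by
    rw [lastColumn_rimEnd hw]
    exact lastColumn_le hT⟩

theorem IsRightmostRimHook.subset {μ : YoungDiagram} {h : ℕ} (hw : h < μ.rowLen 0)
    {T : Finset (ℕ × ℕ)} (hT : IsRightmostRimHook μ h T) : T ⊆ rimEnd μ h := by
  obtain ⟨hA, hR⟩ := hT
  obtain ⟨⟨-, hconn, -⟩, harm, hsub⟩ := hA
  have hlast := hR _ (isRimHookAlong_rimEnd hw)
  rw [lastColumn_rimEnd hw] at hlast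
  obtain ⟨⟨t, ht⟩⟩ := hconn.nonempty
  obtain ⟨m, hm, hmax⟩ := Finset.exists_mem_eq_sup T ⟨t, ht⟩ Prod.snd
  have hm2 : μ.rowLen 0 - 1 ≤ m.2 := by
    rw [← hmax]
    exact hlast
  intro c hc
  have hcr := mem_rim.1 (hsub hc)
  refine mem_rimEnd.2 ⟨hcr.1, hcr.2, ?_⟩
  have hIcc : Finset.Icc c.2 m.2 ⊆ T.image Prod.snd := fun j hj =>
    ordConnected_columns hconn hc hm (Finset.mem_Icc.1 hj).1 (Finset.mem_Icc.1 hj).2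
  have hcard := Finset.card_le_card hIcc
  rw [Nat.card_Icc] at hcard
  unfold armLength at harm
  omega

theorem isLongestRightmostRimHook_iff {μ : YoungDiagram} {h : ℕ} (hw : h < μ.rowLen 0)
    {S : Finset (ℕ × ℕ)} : IsLongestRightmostRimHook μ h S ↔ S = rimEnd μ h := by
  constructor
  · rintro ⟨hS, hmax⟩
    exact Finset.eq_of_subset_of_card_le (hS.subset hw) (hmax _ (isRightmostRimHook_rimEnd hw))
  · rintro rfl
    exact ⟨isRightmostRimHook_rimEnd hw, fun T hT => Finset.card_le_card (hT.subset hw)⟩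

theorem exists_isLongestRightmostRimHook {μ : YoungDiagram} {h : ℕ} (hw : h < μ.rowLen 0) :
    ∃ S, IsLongestRightmostRimHook μ h S :=
  ⟨_, (isLongestRightmostRimHook_iff hw).2 rfl⟩

/-- The diagram left after stripping away from `μ`, which has more than `h` columns, the longest
of the rightmost rim hooks with arm length `h` lying along its rim. -/
noncomputable def strip (μ : YoungDiagram) (h : ℕ) (hw : h < μ.rowLen 0) : YoungDiagram where
  cells := μ.cells \ (exists_isLongestRightmostRimHook hw).choose
  isLowerSet := by
    rw [(isLongestRightmostRimHook_iff hw).1 (exists_isLongestRightmostRimHook hw).choose_spec]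
    exact (sdiffRimEnd μ h).isLowerSet

theorem strip_cells {μ : YoungDiagram} {h : ℕ} (hw : h < μ.rowLen 0) :
    (strip μ h hw).cells = μ.cells \ rimEnd μ h := by
  have hS := (isLongestRightmostRimHook_iff hw).1
    (exists_isLongestRightmostRimHook hw).choose_spec
  exact congrArg (fun S => μ.cells \ S) hS

theorem strip_card_lt {μ : YoungDiagram} {h : ℕ} (hw : h < μ.rowLen 0) :
    (strip μ h hw).card < μ.card := by
  refine Finset.card_lt_card ?_
  rw [strip_cells hw]
  refine Finset.sdiff_ssubset ?_ ⟨_, corner_mem_rimEnd hw⟩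
  exact (Finset.filter_subset _ _).trans (Finset.filter_subset _ _)

/-- The residual diagram: repeat the stripping of rim hooks with arm length `h` until fewer
than `h + 1` columns remain. (The number of columns of `μ` is `μ.rowLen 0`.) -/
noncomputable def residual (h : ℕ) (μ : YoungDiagram) : YoungDiagram :=
  if hw : h < μ.rowLen 0 then residual h (strip μ h hw) else μ
termination_by μ.card
decreasing_by exact strip_card_lt hw

/-! ### The Durfee rectangle and the Frobenius representation -/

/-- The largest `n` such that `μ` contains the rectangle with `n` rows and `n + a` columns:
the vertical side of the Durfee square (`a = 0`) or of the Durfee rectangle (`a = 1`).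
Such an `n` never exceeds the number `μ.colLen 0` of rows of `μ`. -/
def durfeeSide (a : ℕ) (μ : YoungDiagram) : ℕ :=
  Nat.findGreatest (fun n => Finset.range n ×ˢ Finset.range (n + a) ⊆ μ.cells) (μ.colLen 0)

/-- The part of `μ` inside the first `n` rows, to the right of the first `m` columns, as a
diagram of its own. -/
def rightPart (μ : YoungDiagram) (n m : ℕ) : YoungDiagram where
  cells := (μ.cells.filter fun c => c.1 < n ∧ m ≤ c.2).image fun c => (c.1, c.2 - m)
  isLowerSet := by
    rintro _ ⟨i', j'⟩ hle hc
    simp only [Finset.coe_image, Finset.coe_filter, YoungDiagram.mem_cells, Set.mem_image,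
      Set.mem_ofPred_eq] at hc ⊢
    obtain ⟨c, ⟨hc, h1, h2⟩, rfl⟩ := hc
    have hi : i' ≤ c.1 := hle.1
    have hj : j' ≤ c.2 - m := hle.2
    refine ⟨(i', j' + m), ⟨μ.up_left_mem hi (by omega) hc, ?_, ?_⟩, ?_⟩
    · simp only
      omega
    · simp only
      omega
    · simp

/-- The number of cells on the main diagonal. -/
def diagLength (μ : YoungDiagram) : ℕ := (μ.cells.filter fun c => c.1 = c.2).card

/-- The sequence `x₁, …, x_d, x_{d+1}` where `x₁, …, x_d` are the first half of the Frobenius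
representation, so that `xᵢ` is the number of cells to the right of the `i`-th diagonal cell in
its row, and `x_{d+1} = -1`. -/
def frobeniusX (μ : YoungDiagram) (i : ℕ) : ℤ :=
  if i ≤ diagLength μ then (μ.rowLen (i - 1) : ℤ) - i else -1

/-- The sequence `y₀, y₁, …, y_d` where `y₁, …, y_d` are the second half of the Frobenius
representation, so that `yᵢ` is the number of cells below the `i`-th diagonal cell in its column,
and `y₀ = n`. -/
def frobeniusY (μ : YoungDiagram) (n i : ℕ) : ℤ :=
  if i = 0 then (n : ℤ) else (μ.colLen (i - 1) : ℤ) - i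

/-- `max_{0 ≤ i ≤ d} (yᵢ - x_{i+1}) - 1`. -/
def frobeniusMax (μ : YoungDiagram) (n : ℕ) : ℤ :=
  (Finset.range (diagLength μ + 1)).sup' Finset.nonempty_range_add_one
    (fun i => frobeniusY μ n i - frobeniusX μ (i + 1)) - 1

/-! ### The statistics -/

/-- The Ferrers diagram of a partition. -/
def ferrers {n : ℕ} (p : n.Partition) : YoungDiagram :=
  YoungDiagram.ofRowLens (p.parts.sort (· ≥ ·)) (Multiset.pairwise_sort _ _).sortedGE

/-- The statistic `f⁽ᵃ⁾` of a diagram: take the part to the right of the Durfee square (`a = 0`)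
or Durfee rectangle (`a = 1`), with vertical side `n_a`, reduce it by stripping rim hooks with arm
length `n_a + a`, and evaluate `max (yᵢ - x_{i+1}) - 1` on the residual diagram. -/
noncomputable def rankStat (a : ℕ) (μ : YoungDiagram) : ℤ :=
  frobeniusMax
    (residual (durfeeSide a μ + a) (rightPart μ (durfeeSide a μ) (durfeeSide a μ + a)))
    (durfeeSide a μ)

/-- The rerank of a partition. -/
noncomputable def rerank {n : ℕ} (p : n.Partition) : ℤ := rankStat 1 (ferrers p)

/-- `mex_{A,a}`: the smallest positive integer congruent to `a` modulo `A` that is not a part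
of the partition. -/
noncomputable def mex (A a : ℕ) {n : ℕ} (p : n.Partition) : ℕ :=
  sInf {m : ℕ | 0 < m ∧ m ≡ a [MOD A] ∧ m ∉ p.parts}

/-- `p_{A,a}(n)`: the number of partitions of `n` whose `mex_{A,a}` is congruent to `a`
modulo `2A`. -/
noncomputable def mexCount (A a n : ℕ) : ℕ :=
  Nat.card {p : n.Partition // mex A a p ≡ a [MOD 2 * A]}

end MexRerank

/-! Two statistics on the partitions of `n` are compared: the rerank, and `evenRun`, the number `k`
for which 2, 4, ..., 2k are parts but 2k + 2 is not. Since the mex is 2(k + 1), it is 2 mod 4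
exactly when `evenRun` is even. It suffices that the two statistics have the same tail counts
(`card_even_eq`), and for every r both tails are counted by p(n - r(r+1)).

For `evenRun` this is immediate: remove one copy of each of 2, 4, ..., 2r (`genFun_evens_le`).

For the rerank (`genFun_le_rankStat`), cut a diagram along its Durfee rectangle with m rows and m +
1 columns. The part below contributes 1/(q)_{m+1}. Reversing the removal of rim hooks relates the
right parts to their residual diagrams, which lie in a box with m rows and m + 1 columns
(`genFun_residual_mul`). By `genFun_frobeniusClass`, the residual diagrams with Frobenius maximum at
least r have a Gaussian binomial as generating function: there are none for m < r, and for m = r + a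
they are equinumerous, by size, with the diagrams in an a by (a + 2r + 1) box. The factors then
collapse to 1/((q)_a (q)_{a+2r+1}), and since (r+a)(r+a+1) = r(r+1) + a(a+2r+1), the sum over a is
q^{r(r+1)} times the Durfee dissection of all partitions with rectangles a by a + 2r + 1. -/

namespace MexRerank

open PowerSeries

/-! ### Generating functions of weighted sets -/

section GeneratingFunction

variable {α β : Type*}

/-- The generating function of a set whose elements carry a weight. -/
noncomputable def genFun (w : α → ℕ) (S : Set α) : ℤ⟦X⟧ :=
  PowerSeries.mk fun n => (({a ∈ S | w a = n}.ncard : ℕ) : ℤ)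

theorem coeff_genFun (w : α → ℕ) (S : Set α) (n : ℕ) :
    coeff n (genFun w S) = ({a ∈ S | w a = n}.ncard : ℕ) := by
  simp [genFun]

theorem genFun_empty (w : α → ℕ) : genFun w (∅ : Set α) = 0 := by
  ext n
  simp [coeff_genFun]

theorem genFun_singleton {w : α → ℕ} {a : α} (ha : w a = 0) : genFun w {a} = 1 := by
  ext n
  rw [coeff_genFun, coeff_one]
  split_ifs with hn
  · subst hn
    have : {b ∈ ({a} : Set α) | w b = 0} = {a} := by
      ext b
      simp only [Set.mem_singleton_iff, Set.mem_ofPred_eq]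
      exact ⟨fun h => h.1, fun h => ⟨h, h ▸ ha⟩⟩
    rw [this, Set.ncard_singleton]
    rfl
  · have : {b ∈ ({a} : Set α) | w b = n} = ∅ := by
      ext b
      simp only [Set.mem_singleton_iff, Set.mem_ofPred_eq, Set.mem_empty_iff_false, iff_false]
      rintro ⟨rfl, h⟩
      exact hn (h.symm.trans ha)
    rw [this, Set.ncard_empty]
    rfl

theorem genFun_union {w : α → ℕ} (hw : ∀ n, {a | w a = n}.Finite) {S T U : Set α}
    (hST : Disjoint S T) (hU : ∀ a, a ∈ U ↔ a ∈ S ∨ a ∈ T) :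
    genFun w U = genFun w S + genFun w T := by
  ext n
  rw [map_add, coeff_genFun, coeff_genFun, coeff_genFun]
  have : {a ∈ U | w a = n} = {a ∈ S | w a = n} ∪ {a ∈ T | w a = n} := by
    ext a
    simp only [Set.mem_ofPred_eq, Set.mem_union, hU]
    tauto
  rw [this, Set.ncard_union_eq (hST.mono (fun a h => h.1) (fun a h => h.1))
    ((hw n).subset fun a h => h.2) ((hw n).subset fun a h => h.2)]
  push_cast
  rfl

theorem genFun_eq_X_pow_mul {w : α → ℕ} {w' : β → ℕ} {S : Set α} {T : Set β} {c : ℕ}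
    (f : β → α) (hf : Set.BijOn f T S) (hw : ∀ b ∈ T, w (f b) = w' b + c) :
    genFun w S = X ^ c * genFun w' T := by
  ext n
  rw [coeff_X_pow_mul', coeff_genFun]
  split_ifs with hn
  · rw [coeff_genFun]
    have : {a ∈ S | w a = n} = f '' {b ∈ T | w' b = n - c} := by
      ext a
      simp only [Set.mem_ofPred_eq, Set.mem_image]
      constructor
      · rintro ⟨ha, hwa⟩
        obtain ⟨b, hb, rfl⟩ := hf.surjOn ha
        have := hw b hb
        exact ⟨b, ⟨hb, by omega⟩, rfl⟩
      · rintro ⟨b, ⟨hb, hwb⟩, rfl⟩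
        have := hw b hb
        exact ⟨hf.mapsTo hb, by omega⟩
    rw [this, (hf.injOn.mono fun b hb => hb.1).ncard_image]
  · have : {a ∈ S | w a = n} = ∅ := by
      ext a
      simp only [Set.mem_ofPred_eq, Set.mem_empty_iff_false, iff_false]
      rintro ⟨ha, hwa⟩
      obtain ⟨b, hb, rfl⟩ := hf.surjOn ha
      have := hw b hb
      omega
    simp [this]

theorem genFun_eq_of_bijOn {w : α → ℕ} {w' : β → ℕ} {S : Set α} {T : Set β}
    (f : β → α) (hf : Set.BijOn f T S) (hw : ∀ b ∈ T, w (f b) = w' b) :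
    genFun w S = genFun w' T := by
  simpa using genFun_eq_X_pow_mul (c := 0) f hf (by simpa using hw)

theorem genFun_prod {w : α → ℕ} {w' : β → ℕ} (hw : ∀ n, {a | w a = n}.Finite)
    (hw' : ∀ n, {b | w' b = n}.Finite) (S : Set α) (T : Set β) :
    genFun (fun p : α × β => w p.1 + w' p.2) (S ×ˢ T) = genFun w S * genFun w' T := by
  classical
  ext n
  rw [coeff_mul, coeff_genFun]
  simp only [coeff_genFun]
  have hS : ∀ k, {a ∈ S | w a = k}.Finite := fun k => (hw k).subset fun a h => h.2
  have hT : ∀ k, {b ∈ T | w' b = k}.Finite := fun k => (hw' k).subset fun b h => h.2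
  have : {p ∈ S ×ˢ T | w p.1 + w' p.2 = n} =
      ((Finset.HasAntidiagonal.antidiagonal n).biUnion fun k =>
        (hS k.1).toFinset ×ˢ
        (hT k.2).toFinset :
        Finset (α × β)) := by
    ext p
    simp only [Set.mem_ofPred_eq, Set.mem_prod, Finset.coe_biUnion, Finset.mem_coe,
      Finset.HasAntidiagonal.mem_antidiagonal, Finset.coe_product, Set.Finite.coe_toFinset, Set.mem_iUnion,
      exists_prop, Prod.exists]
    constructor
    · rintro ⟨⟨h1, h2⟩, h3⟩
      exact ⟨_, _, h3, ⟨h1, rfl⟩, h2, rfl⟩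
    · rintro ⟨a, b, h3, ⟨h1, h4⟩, h2, h5⟩
      exact ⟨⟨h1, h2⟩, by omega⟩
  rw [this, Set.ncard_coe_finset, Finset.card_biUnion]
  · push_cast
    refine Finset.sum_congr rfl fun k _ => ?_
    rw [Finset.card_product, ← Set.ncard_eq_toFinset_card _ (hS k.1),
      ← Set.ncard_eq_toFinset_card _ (hT k.2)]
    push_cast
    rfl
  · intro k _ l _ hkl
    refine Finset.disjoint_left.2 fun p hp hp' => hkl ?_
    simp only [Finset.mem_product, Set.Finite.mem_toFinset, Set.mem_ofPred_eq] at hp hp'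
    exact Prod.ext (hp.1.2.symm.trans hp'.1.2) (hp.2.2.symm.trans hp'.2.2)

/-- Stated for one coefficient because the statistics summed over (Durfee sides) are bounded only
once the weight is fixed; this avoids infinite sums of power series. -/
theorem coeff_genFun_eq_sum {w : α → ℕ} (hw : ∀ n, {a | w a = n}.Finite) (S : Set α)
    (f : α → ℕ) {n K : ℕ} (hf : ∀ a ∈ S, w a = n → f a < K) :
    coeff n (genFun w S) = ∑ m ∈ Finset.range K, coeff n (genFun w {a ∈ S | f a = m}) := by
  classical
  simp only [coeff_genFun]
  have hfin : {a ∈ S | w a = n}.Finite := (hw n).subset fun a h => h.2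
  rw [Set.ncard_eq_toFinset_card _ hfin,
    Finset.card_eq_sum_card_fiberwise (f := f) (t := Finset.range K)]
  · push_cast
    refine Finset.sum_congr rfl fun m _ => ?_
    rw [← Set.ncard_coe_finset]
    congr 2
    ext a
    simp only [Finset.coe_filter, Set.Finite.mem_toFinset, Set.mem_ofPred_eq]
    tauto
  · intro a ha
    simp only [Set.Finite.coe_toFinset, Set.mem_ofPred_eq] at ha
    simpa using hf a ha.1 ha.2

end GeneratingFunction

/-! ### Diagrams and their row lengths -/

theorem ext_rowLen {μ ν : YoungDiagram} (h : ∀ i, μ.rowLen i = ν.rowLen i) : μ = ν := by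
  ext ⟨i, j⟩
  simp only [YoungDiagram.mem_cells, YoungDiagram.mem_iff_lt_rowLen, h]

theorem rowLen_eq_of_mem_iff {μ : YoungDiagram} {i k : ℕ} (h : ∀ j, (i, j) ∈ μ ↔ j < k) :
    μ.rowLen i = k := by
  simp only [YoungDiagram.mem_iff_lt_rowLen] at h
  exact eq_of_forall_lt_iff h

theorem colLen_eq_of_mem_iff {μ : YoungDiagram} {j k : ℕ} (h : ∀ i, (i, j) ∈ μ ↔ i < k) :
    μ.colLen j = k := by
  simp only [YoungDiagram.mem_iff_lt_colLen] at h
  exact eq_of_forall_lt_iff h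

theorem lt_rowLen_iff_lt_colLen {μ : YoungDiagram} {i j : ℕ} :
    j < μ.rowLen i ↔ i < μ.colLen j := by
  rw [← YoungDiagram.mem_iff_lt_rowLen, YoungDiagram.mem_iff_lt_colLen]

theorem colLen_zero_le_iff {μ : YoungDiagram} {m : ℕ} : μ.colLen 0 ≤ m ↔ μ.rowLen m = 0 := by
  rw [← not_lt, ← lt_rowLen_iff_lt_colLen]
  omega

/-- The diagram with given row lengths. -/
def ofRows (f : ℕ → ℕ) (hf : Antitone f) (K : ℕ) : YoungDiagram where
  cells := (Finset.range K ×ˢ Finset.range (f 0)).filter fun c => c.2 < f c.1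
  isLowerSet := by
    intro c c' hle hc
    simp only [Finset.coe_filter, Finset.mem_product, Finset.mem_range, Set.mem_ofPred_eq] at hc ⊢
    have h1 : c'.1 ≤ c.1 := hle.1
    have h2 : c'.2 ≤ c.2 := hle.2
    have := hf h1
    omega

theorem rowLen_ofRows {f : ℕ → ℕ} (hf : Antitone f) {K : ℕ} (hK : f K = 0) (i : ℕ) :
    (ofRows f hf K).rowLen i = f i := by
  refine rowLen_eq_of_mem_iff fun j => ?_
  rw [← YoungDiagram.mem_cells]
  simp only [ofRows, Finset.mem_filter, Finset.mem_product, Finset.mem_range]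
  refine ⟨fun h => h.2, fun h => ⟨⟨?_, h.trans_le (hf (Nat.zero_le i))⟩, h⟩⟩
  by_contra hi
  have := hf (not_lt.1 hi)
  omega

theorem card_eq_sum_rowLen (μ : YoungDiagram) {m : ℕ} (hm : μ.rowLen m = 0) :
    μ.card = ∑ i ∈ Finset.range m, μ.rowLen i := by
  have : μ.cells = ((Finset.range m).sigma fun i => Finset.range (μ.rowLen i)).map
      (Equiv.sigmaEquivProd ℕ ℕ).toEmbedding := by
    ext ⟨i, j⟩
    simp only [YoungDiagram.mem_cells, YoungDiagram.mem_iff_lt_rowLen, Finset.mem_map_equiv,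
      Finset.mem_sigma, Finset.mem_range, Equiv.sigmaEquivProd_symm_apply]
    refine ⟨fun h => ⟨?_, h⟩, fun h => h.2⟩
    by_contra hi
    have := μ.rowLen_anti _ _ (not_lt.1 hi)
    omega
  rw [YoungDiagram.card, this, Finset.card_map, Finset.card_sigma]
  simp

theorem rowLen_bot (i : ℕ) : (⊥ : YoungDiagram).rowLen i = 0 :=
  rowLen_eq_of_mem_iff fun j => by simp

theorem eq_bot_iff_rowLen {μ : YoungDiagram} : μ = ⊥ ↔ μ.rowLen 0 = 0 := by
  constructor
  · rintro rfl
    exact rowLen_bot 0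
  · intro h
    refine ext_rowLen fun i => ?_
    have := μ.rowLen_anti 0 i (Nat.zero_le i)
    rw [rowLen_bot]
    omega

theorem rowLen_le_card (μ : YoungDiagram) (i : ℕ) : μ.rowLen i ≤ μ.card := by
  rw [YoungDiagram.rowLen_eq_card]
  exact Finset.card_le_card (Finset.filter_subset _ _)

theorem colLen_le_card (μ : YoungDiagram) (i : ℕ) : μ.colLen i ≤ μ.card := by
  rw [YoungDiagram.colLen_eq_card]
  exact Finset.card_le_card (Finset.filter_subset _ _)

theorem card_transpose (μ : YoungDiagram) : μ.transpose.card = μ.card := by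
  simp [YoungDiagram.card, YoungDiagram.transpose]

theorem finite_card_eq (n : ℕ) : {μ : YoungDiagram | μ.card = n}.Finite := by
  refine Set.Finite.of_finite_image (f := YoungDiagram.cells)
    ((Finset.finite_toSet (Finset.range n ×ˢ Finset.range n).powerset).subset ?_) ?_
  · rintro _ ⟨μ, rfl, rfl⟩
    simp only [Finset.mem_coe, Finset.mem_powerset]
    rintro ⟨i, j⟩ hc
    rw [YoungDiagram.mem_cells] at hc
    simp only [Finset.mem_product, Finset.mem_range]
    exact ⟨(YoungDiagram.mem_iff_lt_colLen.1 hc).trans_le (colLen_le_card μ j),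
      (YoungDiagram.mem_iff_lt_rowLen.1 hc).trans_le (rowLen_le_card μ i)⟩
  · intro μ _ ν _ h
    exact YoungDiagram.ext h

/-- The generating function, by the number of cells, of a set of diagrams. -/
noncomputable abbrev cellGenFun (S : Set YoungDiagram) : ℤ⟦X⟧ := genFun YoungDiagram.card S

/-- The diagrams with at most `m` rows. -/
def rowsLE (m : ℕ) : Set YoungDiagram := {μ | μ.rowLen m = 0}

/-- The diagrams with at most `a` rows and at most `b` columns. -/
def box (a b : ℕ) : Set YoungDiagram := {μ | μ.rowLen a = 0 ∧ μ.rowLen 0 ≤ b}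

/-! ### Stripping rim hooks -/

/-- A cell `(i, j)` of `μ` survives iff its diagonal successor is in `μ`, or it lies to the left of
the last `h + 1` columns; the two arguments of `max` are these two cutoffs. -/
theorem rowLen_sdiffRimEnd (μ : YoungDiagram) (h i : ℕ) :
    (sdiffRimEnd μ h).rowLen i =
      max (μ.rowLen (i + 1) - 1) (min (μ.rowLen i) (μ.rowLen 0 - (h + 1))) := by
  refine rowLen_eq_of_mem_iff fun j => ?_
  rw [← YoungDiagram.mem_cells]
  simp only [sdiffRimEnd, Finset.mem_sdiff, YoungDiagram.mem_cells, mem_rimEnd,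
    YoungDiagram.mem_iff_lt_rowLen]
  have := μ.rowLen_anti i (i + 1) (Nat.le_succ i)
  omega

theorem residual_of_lt {μ : YoungDiagram} {h : ℕ} (hw : h < μ.rowLen 0) :
    residual h μ = residual h (sdiffRimEnd μ h) := by
  rw [residual, dif_pos hw]
  congr 1
  exact YoungDiagram.ext (strip_cells hw)

theorem residual_of_le {μ : YoungDiagram} {h : ℕ} (hw : μ.rowLen 0 ≤ h) : residual h μ = μ := by
  rw [residual, dif_neg (not_lt.2 hw)]

/-- The row lengths after the insertion of a rim hook that ends in row `j` and starts `h` columns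
further right in row `0`. -/
def insertRows (h j : ℕ) (μ : YoungDiagram) (i : ℕ) : ℕ :=
  if i = 0 then max (μ.rowLen 0) (μ.rowLen j + h) + 1
  else if i ≤ j then μ.rowLen (i - 1) + 1 else μ.rowLen i

theorem antitone_insertRows (h j : ℕ) (μ : YoungDiagram) : Antitone (insertRows h j μ) := by
  refine antitone_nat_of_succ_le fun i => ?_
  simp only [insertRows]
  have h1 := μ.rowLen_anti i (i + 1) (Nat.le_succ i)
  have h2 := μ.rowLen_anti (i - 1) i (Nat.sub_le i 1)
  have h3 := μ.rowLen_anti 0 i (Nat.zero_le i)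
  rw [if_neg (Nat.succ_ne_zero i), Nat.add_sub_cancel]
  split_ifs <;> (try subst i) <;> omega

/-- The diagram obtained by the insertion of a rim hook into the first `j + 1` rows. -/
def insertRim (h j : ℕ) (μ : YoungDiagram) : YoungDiagram :=
  ofRows (insertRows h j μ) (antitone_insertRows h j μ) (μ.colLen 0 + j + 1)

theorem rowLen_insertRim (h j : ℕ) (μ : YoungDiagram) (i : ℕ) :
    (insertRim h j μ).rowLen i = insertRows h j μ i := by
  refine rowLen_ofRows _ ?_ i
  have : μ.rowLen (μ.colLen 0 + j + 1) = 0 := colLen_zero_le_iff.1 (by omega)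
  rw [insertRows, if_neg (by omega), if_neg (by omega), this]

/-- The inserted hook spans `h + 1` columns and `j + 1` rows. In terms of row lengths, rows `0, ...,
j - 1` move down and grow by 1, while row `j` moves to the top and grows by `h + 1`. -/
theorem card_insertRim {h j m : ℕ} {μ : YoungDiagram} (hj : j < m) (hm : μ.rowLen m = 0)
    (hμ : μ.rowLen 0 ≤ μ.rowLen j + h) : (insertRim h j μ).card = μ.card + (h + 1 + j) := by
  obtain ⟨t, rfl⟩ : ∃ t, m = j + 1 + t := ⟨m - (j + 1), by omega⟩
  have hm' : (insertRim h j μ).rowLen (j + 1 + t) = 0 := by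
    rw [rowLen_insertRim, insertRows, if_neg (by omega), if_neg (by omega), hm]
  rw [card_eq_sum_rowLen _ hm', card_eq_sum_rowLen _ hm, Finset.sum_range_add _ (j + 1),
    Finset.sum_range_add _ (j + 1), Finset.sum_range_succ', Finset.sum_range_succ]
  have h1 : ∀ i ∈ Finset.range j, (insertRim h j μ).rowLen (i + 1) = μ.rowLen i + 1 := by
    intro i hi
    rw [Finset.mem_range] at hi
    rw [rowLen_insertRim, insertRows, if_neg (by omega), if_pos (by omega), Nat.add_sub_cancel]
  have h2 : ∀ i ∈ Finset.range t,
      (insertRim h j μ).rowLen (j + 1 + i) = μ.rowLen (j + 1 + i) := by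
    intro i _
    rw [rowLen_insertRim, insertRows, if_neg (by omega), if_neg (by omega)]
  have h3 : (insertRim h j μ).rowLen 0 = μ.rowLen j + h + 1 := by
    rw [rowLen_insertRim, insertRows, if_pos rfl]
    omega
  rw [Finset.sum_congr rfl h1, Finset.sum_congr rfl h2, h3, Finset.sum_add_distrib,
    Finset.sum_const, Finset.card_range, smul_eq_mul]
  omega

/-- Under `hμ` the `max` in `insertRows` is `μ.rowLen j + h`; it is there only to keep the rows
antitone for arbitrary `μ`. -/
theorem sdiffRimEnd_insertRim {h j : ℕ} {μ : YoungDiagram} (hμ : μ.rowLen 0 ≤ μ.rowLen j + h) :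
    sdiffRimEnd (insertRim h j μ) h = μ := by
  refine ext_rowLen fun i => ?_
  simp only [rowLen_sdiffRimEnd, rowLen_insertRim, insertRows, Nat.add_sub_cancel, if_true]
  have h1 := μ.rowLen_anti i (i + 1) (Nat.le_succ i)
  have h2 := μ.rowLen_anti (i - 1) i (Nat.sub_le i 1)
  have h3 : i ≤ j → μ.rowLen j ≤ μ.rowLen i := μ.rowLen_anti i j
  have h4 : j ≤ i → μ.rowLen i ≤ μ.rowLen j := μ.rowLen_anti j i
  rcases Nat.eq_zero_or_pos i with rfl | hi
  · rcases Nat.eq_zero_or_pos j with rfl | hj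
    · simp only [zero_add, one_ne_zero, if_false, nonpos_iff_eq_zero, if_true] at *
      omega
    · rw [if_neg (by omega), if_pos (by omega), if_pos rfl]
      omega
  · rcases lt_trichotomy i j with hij | rfl | hij
    · rw [if_neg (by omega), if_pos (by omega), if_neg (by omega), if_pos (by omega)]
      omega
    · rw [if_neg (by omega), if_neg (by omega), if_neg (by omega), if_pos (by omega)]
      omega
    · rw [if_neg (by omega), if_neg (by omega), if_neg (by omega), if_neg (by omega)]
      omega

/-- The two hypotheses say that row `j` is the last one to reach the final `h + 1` columns, so the
removed hook ends there. -/
theorem rowLen_sdiffRimEnd_of_lt {h j : ℕ} {μ : YoungDiagram} (h0 : μ.rowLen 0 ≤ μ.rowLen j + h)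
    (h1 : μ.rowLen (j + 1) + h < μ.rowLen 0) (i : ℕ) :
    (sdiffRimEnd μ h).rowLen i =
      if i < j then μ.rowLen (i + 1) - 1
      else if i = j then μ.rowLen 0 - (h + 1) else μ.rowLen i := by
  rw [rowLen_sdiffRimEnd]
  have h2 := μ.rowLen_anti i (i + 1) (Nat.le_succ i)
  have h3 : i + 1 ≤ j → μ.rowLen j ≤ μ.rowLen (i + 1) := μ.rowLen_anti (i + 1) j
  have h4 : j + 1 ≤ i → μ.rowLen i ≤ μ.rowLen (j + 1) := μ.rowLen_anti (j + 1) i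
  split_ifs with h5 h6
  · omega
  · subst h6
    omega
  · omega

theorem insertRim_sdiffRimEnd {h j : ℕ} {μ : YoungDiagram} (h0 : μ.rowLen 0 ≤ μ.rowLen j + h)
    (h1 : μ.rowLen (j + 1) + h < μ.rowLen 0) : insertRim h j (sdiffRimEnd μ h) = μ := by
  refine ext_rowLen fun i => ?_
  simp only [rowLen_insertRim, insertRows, rowLen_sdiffRimEnd_of_lt h0 h1, lt_irrefl, if_true,
    if_false]
  rcases Nat.eq_zero_or_pos i with rfl | hi
  · have := μ.rowLen_anti 0 1 (Nat.zero_le 1)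
    rw [if_pos rfl]
    split_ifs <;> (try simp only [zero_add] at *) <;> omega
  · rw [if_neg (by omega)]
    split_ifs with h2 h3 h4
    · have := μ.rowLen_anti i j h2
      rw [Nat.sub_add_cancel hi]
      omega
    all_goals omega

/-- The diagrams with at most `m` rows and residual diagram in `Q`, whose first row is at most
`h` cells longer than row `j`. -/
def stripClass (m h : ℕ) (Q : Set YoungDiagram) (j : ℕ) : Set YoungDiagram :=
  {μ | μ.rowLen m = 0 ∧ residual h μ ∈ Q ∧ μ.rowLen 0 ≤ μ.rowLen j + h}

theorem bijOn_insertRim {m h j : ℕ} (Q : Set YoungDiagram) (hj : j < m) :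
    Set.BijOn (insertRim h j) (stripClass m h Q j)
      {μ ∈ stripClass m h Q j | μ.rowLen (j + 1) + h < μ.rowLen 0} := by
  refine Set.InvOn.bijOn (f' := fun μ => sdiffRimEnd μ h)
    ⟨fun μ hμ => sdiffRimEnd_insertRim hμ.2.2, fun μ hμ => insertRim_sdiffRimEnd hμ.1.2.2 hμ.2⟩
    ?_ ?_
  · rintro μ ⟨h1, h2, h3⟩
    have h4 : (insertRim h j μ).rowLen 0 = μ.rowLen j + h + 1 := by
      rw [rowLen_insertRim, insertRows, if_pos rfl]
      omega
    have h5 := μ.rowLen_anti j (j + 1) (Nat.le_succ j)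
    have h6 := μ.rowLen_anti (j - 1) j (Nat.sub_le j 1)
    refine ⟨⟨?_, ?_, ?_⟩, ?_⟩
    · rw [rowLen_insertRim, insertRows, if_neg (by omega), if_neg (by omega), h1]
    · rwa [residual_of_lt (by omega), sdiffRimEnd_insertRim h3]
    · rw [h4, rowLen_insertRim, insertRows]
      split_ifs <;> omega
    · rw [h4, rowLen_insertRim, insertRows, if_neg (by omega), if_neg (by omega)]
      omega
  · rintro μ ⟨⟨h1, h2, h3⟩, h4⟩
    refine ⟨?_, ?_, ?_⟩
    · have := μ.rowLen_anti m (m + 1) (Nat.le_succ m)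
      rw [rowLen_sdiffRimEnd]
      omega
    · rwa [← residual_of_lt (by omega)]
    · simp only [rowLen_sdiffRimEnd_of_lt h3 h4, lt_irrefl, if_false, if_true]
      have := μ.rowLen_anti 0 1 (Nat.zero_le 1)
      split_ifs <;> (try simp only [zero_add] at *) <;> omega

/-- Either the hook to be removed ends in row `j`, and its removal is a bijection back onto the
whole class `j`, or it ends lower and the diagram is in class `j + 1`. Hence `G_j = X ^ (h + 1 + j)
* G_j + G_{j+1}`. -/
theorem genFun_stripClass_mul {m h j : ℕ} (Q : Set YoungDiagram) (hj : j < m) :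
    cellGenFun (stripClass m h Q j) * (1 - X ^ (h + 1 + j)) =
      cellGenFun (stripClass m h Q (j + 1)) := by
  have h1 := genFun_eq_X_pow_mul _ (bijOn_insertRim (h := h) Q hj)
    (w := YoungDiagram.card) (w' := YoungDiagram.card) (c := h + 1 + j)
    fun μ hμ => card_insertRim hj hμ.1 hμ.2.2
  have h2 := genFun_union finite_card_eq
    (S := {μ ∈ stripClass m h Q j | μ.rowLen (j + 1) + h < μ.rowLen 0})
    (T := stripClass m h Q (j + 1)) (U := stripClass m h Q j) ?_ ?_
  · rw [h1] at h2
    linear_combination h2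
  · exact Set.disjoint_left.2 fun μ h1 h2 => absurd h2.2.2 (not_le.2 h1.2)
  · intro μ
    have := μ.rowLen_anti j (j + 1) (Nat.le_succ j)
    simp only [stripClass, Set.mem_ofPred_eq]
    constructor
    · rintro ⟨h1, h2, h3⟩
      by_cases h4 : μ.rowLen (j + 1) + h < μ.rowLen 0
      · exact Or.inl ⟨⟨h1, h2, h3⟩, h4⟩
      · exact Or.inr ⟨h1, h2, not_lt.1 h4⟩
    · rintro (h1 | ⟨h1, h2, h3⟩)
      · exact h1.1
      · exact ⟨h1, h2, by omega⟩

/-- Diagrams with at most `m` rows and a given kind of residual diagram. -/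
theorem genFun_residual_mul (m h : ℕ) (Q : Set YoungDiagram) :
    cellGenFun {μ | μ.rowLen m = 0 ∧ residual h μ ∈ Q} *
        ∏ k ∈ Finset.range m, (1 - X ^ (h + 1 + k)) =
      cellGenFun {μ | μ ∈ Q ∧ μ ∈ box m h} := by
  have key : ∀ j ≤ m, cellGenFun (stripClass m h Q 0) *
      ∏ k ∈ Finset.range j, (1 - X ^ (h + 1 + k)) = cellGenFun (stripClass m h Q j) := by
    intro j
    induction j with
    | zero => simp
    | succ j ih =>
      intro hj
      rw [Finset.prod_range_succ, ← mul_assoc, ih (by omega), genFun_stripClass_mul Q hj]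
  have h0 : stripClass m h Q 0 = {μ | μ.rowLen m = 0 ∧ residual h μ ∈ Q} := by
    ext μ
    simp [stripClass]
  -- Row `m` is empty, so the first row has length at most `h` and nothing is stripped.
  have h1 : stripClass m h Q m = {μ | μ ∈ Q ∧ μ ∈ box m h} := by
    ext μ
    simp only [stripClass, box, Set.mem_ofPred_eq]
    constructor
    · rintro ⟨h1, h2, h3⟩
      rw [h1, zero_add] at h3
      rw [residual_of_le h3] at h2
      exact ⟨h2, h1, h3⟩
    · rintro ⟨h2, h1, h3⟩
      rw [residual_of_le h3]
      exact ⟨h1, h2, by omega⟩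
  rw [← h0, key m le_rfl, h1]

/-! ### Diagrams in a box -/

/-- The product `(1 - X) ⋯ (1 - Xⁿ)`. -/
noncomputable def qFactorial (n : ℕ) : ℤ⟦X⟧ := ∏ k ∈ Finset.range n, (1 - X ^ (k + 1))

theorem one_sub_X_pow_ne_zero {k : ℕ} (hk : 0 < k) : (1 - X ^ k : ℤ⟦X⟧) ≠ 0 := by
  intro h
  have := congrArg (coeff 0) h
  rw [map_sub, coeff_X_pow, if_neg hk.ne] at this
  simp at this

theorem qFactorial_ne_zero (n : ℕ) : qFactorial n ≠ 0 :=
  Finset.prod_ne_zero_iff.2 fun k _ => one_sub_X_pow_ne_zero (Nat.succ_pos k)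

theorem qFactorial_succ (n : ℕ) : qFactorial (n + 1) = qFactorial n * (1 - X ^ (n + 1)) :=
  Finset.prod_range_succ _ n

theorem qFactorial_add (a b : ℕ) :
    qFactorial (a + b) = qFactorial a * ∏ k ∈ Finset.range b, (1 - X ^ (a + 1 + k)) := by
  rw [qFactorial, Finset.prod_range_add]
  congr 1
  refine Finset.prod_congr rfl fun k _ => ?_
  congr 2
  omega

theorem box_zero_left (b : ℕ) : box 0 b = {⊥} := by
  ext μ
  simp only [box, Set.mem_ofPred_eq, Set.mem_singleton_iff, eq_bot_iff_rowLen]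
  omega

theorem box_zero_right (a : ℕ) : box a 0 = {⊥} := by
  ext μ
  simp only [box, Set.mem_ofPred_eq, Set.mem_singleton_iff, eq_bot_iff_rowLen]
  have := μ.rowLen_anti 0 a (Nat.zero_le a)
  omega

theorem card_bot : (⊥ : YoungDiagram).card = 0 := by simp [YoungDiagram.card]

/-- For `h = 0` the stripped hooks are whole last columns, and the residual diagram is always empty.
-/
theorem genFun_rowsLE_mul (m : ℕ) : cellGenFun (rowsLE m) * qFactorial m = 1 := by
  have := genFun_residual_mul m 0 Set.univ
  simp only [Set.mem_univ, and_true, true_and, zero_add, Set.ofPred_mem_eq, box_zero_right,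
    add_comm 1, genFun_singleton card_bot] at this
  exact this

/-- The Gaussian binomial formula: with no condition on the residual diagram, stripping compares all
diagrams with at most `a` rows to those in the box. -/
theorem genFun_box_mul (a b : ℕ) :
    cellGenFun (box a b) * (qFactorial a * qFactorial b) = qFactorial (a + b) := by
  have := genFun_residual_mul a b Set.univ
  simp only [Set.mem_univ, and_true, true_and, Set.ofPred_mem_eq] at this
  rw [← this, add_comm a b, qFactorial_add]
  have h2 := genFun_rowsLE_mul a
  simp only [rowsLE] at h2
  linear_combination (∏ k ∈ Finset.range a, (1 - X ^ (b + 1 + k))) * qFactorial b * h2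

theorem genFun_box_comm (a b : ℕ) : cellGenFun (box a b) = cellGenFun (box b a) := by
  refine mul_right_cancel₀ (mul_ne_zero (qFactorial_ne_zero a) (qFactorial_ne_zero b)) ?_
  rw [genFun_box_mul, mul_comm (qFactorial a), genFun_box_mul, add_comm]

theorem genFun_box_succ_succ (a b : ℕ) :
    cellGenFun (box (a + 1) (b + 1)) =
      cellGenFun (box (a + 1) b) + X ^ (b + 1) * cellGenFun (box a (b + 1)) := by
  refine mul_right_cancel₀
    (mul_ne_zero (qFactorial_ne_zero (a + 1)) (qFactorial_ne_zero (b + 1))) ?_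
  have h1 := genFun_box_mul (a + 1) (b + 1)
  have h2 := genFun_box_mul (a + 1) b
  have h3 := genFun_box_mul a (b + 1)
  rw [show a + 1 + (b + 1) = a + b + 1 + 1 by ring, qFactorial_succ (a + b + 1)] at h1
  rw [show a + 1 + b = a + b + 1 by ring] at h2
  rw [show a + (b + 1) = a + b + 1 by ring] at h3
  rw [h1]
  have h4 := qFactorial_succ a
  have h5 := qFactorial_succ b
  rw [h5] at h3 ⊢
  rw [h4] at h2 ⊢
  linear_combination (-1 + X ^ (b + 1)) * h2 - X ^ (b + 1) * (1 - X ^ (a + 1)) * h3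

theorem genFun_box_succ_succ' (a b : ℕ) :
    cellGenFun (box (a + 1) (b + 1)) =
      cellGenFun (box a (b + 1)) + X ^ (a + 1) * cellGenFun (box (a + 1) b) := by
  rw [genFun_box_comm, genFun_box_succ_succ, genFun_box_comm a, genFun_box_comm (a + 1) b]

/-! ### The Frobenius representation and the first hook -/

theorem diag_mem_iff {μ : YoungDiagram} {i : ℕ} : (i, i) ∈ μ ↔ i < diagLength μ := by
  have hex : ∃ D, (D, D) ∉ μ := by
    refine ⟨μ.card, fun h => ?_⟩
    have := YoungDiagram.mem_iff_lt_rowLen.1 h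
    have := rowLen_le_card μ μ.card
    omega
  classical
  have h1 : ∀ i, (i, i) ∈ μ ↔ i < Nat.find hex := by
    intro i
    constructor
    · intro hi
      by_contra h
      exact Nat.find_spec hex (μ.up_left_mem (not_lt.1 h) (not_lt.1 h) hi)
    · intro hi
      exact not_not.1 (Nat.find_min hex hi)
  have h2 : (μ.cells.filter fun c => c.1 = c.2) =
      (Finset.range (Nat.find hex)).map ⟨fun i => (i, i), fun i j h => congrArg Prod.fst h⟩ := by
    ext ⟨i, j⟩
    simp only [Finset.mem_filter, YoungDiagram.mem_cells, Finset.mem_map, Finset.mem_range]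
    constructor
    · rintro ⟨h, rfl⟩
      exact ⟨i, (h1 i).1 h, rfl⟩
    · rintro ⟨k, hk, ⟨⟩⟩
      exact ⟨(h1 i).2 hk, rfl⟩
  rw [h1 i, diagLength, h2, Finset.card_map, Finset.card_range]

theorem antitone_peelRows (μ : YoungDiagram) : Antitone fun i => μ.rowLen (i + 1) - 1 :=
  fun i j hij => by
    have := μ.rowLen_anti (i + 1) (j + 1) (by omega)
    simp only
    omega

/-- The diagram without its first row and column. -/
def peel (μ : YoungDiagram) : YoungDiagram :=
  ofRows (fun i => μ.rowLen (i + 1) - 1) (antitone_peelRows μ) (μ.colLen 0)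

theorem rowLen_peel (μ : YoungDiagram) (i : ℕ) : (peel μ).rowLen i = μ.rowLen (i + 1) - 1 := by
  refine rowLen_ofRows _ ?_ i
  have : μ.rowLen (μ.colLen 0 + 1) = 0 := colLen_zero_le_iff.1 (Nat.le_succ _)
  simp only [this, Nat.zero_sub]

theorem mem_peel {μ : YoungDiagram} {i j : ℕ} : (i, j) ∈ peel μ ↔ (i + 1, j + 1) ∈ μ := by
  rw [YoungDiagram.mem_iff_lt_rowLen, YoungDiagram.mem_iff_lt_rowLen, rowLen_peel]
  omega

theorem colLen_peel (μ : YoungDiagram) (j : ℕ) : (peel μ).colLen j = μ.colLen (j + 1) - 1 := by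
  refine colLen_eq_of_mem_iff fun i => ?_
  rw [mem_peel, YoungDiagram.mem_iff_lt_colLen]
  omega

theorem diagLength_peel (μ : YoungDiagram) : diagLength (peel μ) = diagLength μ - 1 := by
  refine eq_of_forall_lt_iff fun i => ?_
  rw [← diag_mem_iff, mem_peel, diag_mem_iff]
  omega

theorem diagLength_eq_zero_iff {μ : YoungDiagram} : diagLength μ = 0 ↔ μ.rowLen 0 = 0 := by
  have h1 := diag_mem_iff (μ := μ) (i := 0)
  rw [YoungDiagram.mem_iff_lt_rowLen] at h1
  omega

theorem le_frobeniusMax_iff {μ : YoungDiagram} {n : ℕ} {r : ℤ} :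
    r ≤ frobeniusMax μ n ↔
      ∃ i ≤ diagLength μ, r + 1 ≤ frobeniusY μ n i - frobeniusX μ (i + 1) := by
  rw [frobeniusMax, le_sub_iff_add_le, Finset.le_sup'_iff]
  simp only [Finset.mem_range, Nat.lt_succ_iff]

theorem frobenius_zero (μ : YoungDiagram) (n : ℕ) :
    frobeniusY μ n 0 - frobeniusX μ 1 = n - μ.rowLen 0 + 1 := by
  simp only [frobeniusY, frobeniusX, if_true]
  have := diagLength_eq_zero_iff (μ := μ)
  split_ifs with h
  · simp only [Nat.sub_self]
    push_cast
    ring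
  · rw [this.1 (by omega)]
    push_cast
    ring

theorem frobeniusY_peel {μ : YoungDiagram} {n i : ℕ} (hi : i + 1 ≤ diagLength μ) :
    frobeniusY (peel μ) (μ.colLen 0 - 1) i = frobeniusY μ n (i + 1) := by
  have h1 : 0 < μ.colLen i :=
    (Nat.zero_le i).trans_lt (YoungDiagram.mem_iff_lt_colLen.1 (diag_mem_iff.2 hi))
  simp only [frobeniusY, Nat.succ_ne_zero, if_false, Nat.add_sub_cancel]
  rcases i with _ | i
  · simp only [if_true, zero_add]
    omega
  · simp only [Nat.succ_ne_zero, if_false, Nat.add_sub_cancel, colLen_peel]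
    omega

theorem frobeniusX_peel {μ : YoungDiagram} {i : ℕ} :
    frobeniusX (peel μ) (i + 1) = frobeniusX μ (i + 1 + 1) := by
  simp only [frobeniusX, diagLength_peel, Nat.add_sub_cancel, rowLen_peel]
  by_cases h : i + 1 + 1 ≤ diagLength μ
  · have h1 : 0 < μ.rowLen (i + 1) :=
      (Nat.zero_le _).trans_lt (YoungDiagram.mem_iff_lt_rowLen.1 (diag_mem_iff.2 h))
    rw [if_pos h, if_pos (by omega)]
    omega
  · rw [if_neg h, if_neg (by omega)]

/-- The term `i = 0` equals `n - μ.rowLen 0 + 1`, also when `d = 0` because then `x₁ = -1`. The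
other terms are those of the diagram without its first hook, whose leg `y₁` takes over the role of
`y₀`. -/
theorem le_frobeniusMax_iff_peel {μ : YoungDiagram} {n r : ℕ} :
    (r : ℤ) ≤ frobeniusMax μ n ↔
      r + μ.rowLen 0 ≤ n ∨
        0 < μ.rowLen 0 ∧ (r : ℤ) ≤ frobeniusMax (peel μ) (μ.colLen 0 - 1) := by
  have hd := diagLength_eq_zero_iff (μ := μ)
  have hp := diagLength_peel μ
  rw [le_frobeniusMax_iff, le_frobeniusMax_iff]
  constructor
  · rintro ⟨i, hi, h⟩
    rcases i with _ | i
    · rw [frobenius_zero] at h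
      left
      omega
    · refine Or.inr ⟨by omega, i, by omega, ?_⟩
      rw [frobeniusY_peel (n := n) hi, frobeniusX_peel]
      exact h
  · rintro (h | ⟨h0, i, hi, h⟩)
    · refine ⟨0, Nat.zero_le _, ?_⟩
      rw [frobenius_zero]
      omega
    · have hi' : i + 1 ≤ diagLength μ := by omega
      rw [frobeniusY_peel (n := n) hi', frobeniusX_peel] at h
      exact ⟨i + 1, hi', h⟩

/-! ### Attaching a hook -/

/-- The row lengths after a hook with arm `M` and leg `N` has been attached. -/
def hookRows (N M : ℕ) (μ : YoungDiagram) (i : ℕ) : ℕ :=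
  if i = 0 then M + 1 else if i ≤ N then min (μ.rowLen (i - 1)) M + 1 else 0

theorem antitone_hookRows (N M : ℕ) (μ : YoungDiagram) : Antitone (hookRows N M μ) := by
  refine antitone_nat_of_succ_le fun i => ?_
  simp only [hookRows]
  have h2 := μ.rowLen_anti (i - 1) i (Nat.sub_le i 1)
  rw [if_neg (Nat.succ_ne_zero i), Nat.add_sub_cancel]
  split_ifs <;> omega

/-- The diagram obtained by attaching a hook with arm `M` and leg `N`. -/
def attachHook (N M : ℕ) (μ : YoungDiagram) : YoungDiagram :=
  ofRows (hookRows N M μ) (antitone_hookRows N M μ) (N + 1)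

theorem rowLen_attachHook (N M : ℕ) (μ : YoungDiagram) (i : ℕ) :
    (attachHook N M μ).rowLen i = hookRows N M μ i := by
  refine rowLen_ofRows _ ?_ i
  rw [hookRows, if_neg (by omega), if_neg (by omega)]

/-- Inside the box the truncation by `min` in `hookRows` has no effect. -/
theorem peel_attachHook {N M : ℕ} {μ : YoungDiagram} (hμ : μ ∈ box N M) :
    peel (attachHook N M μ) = μ := by
  refine ext_rowLen fun i => ?_
  rw [rowLen_peel, rowLen_attachHook, hookRows, if_neg (Nat.succ_ne_zero i), Nat.add_sub_cancel]
  have h1 := μ.rowLen_anti 0 i (Nat.zero_le i)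
  have h2 : N ≤ i → μ.rowLen i ≤ μ.rowLen N := μ.rowLen_anti N i
  have h3 := hμ.1
  have h4 := hμ.2
  split_ifs <;> omega

theorem attachHook_peel {N M : ℕ} {μ : YoungDiagram} (hr : μ.rowLen 0 = M + 1)
    (hc : μ.colLen 0 = N + 1) : attachHook N M (peel μ) = μ := by
  refine ext_rowLen fun i => ?_
  rw [rowLen_attachHook, hookRows]
  have h1 := μ.rowLen_anti 0 i (Nat.zero_le i)
  have h2 := lt_rowLen_iff_lt_colLen (μ := μ) (i := i) (j := 0)
  split_ifs with h3 h4
  · rw [h3, hr]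
  · rw [rowLen_peel, Nat.sub_add_cancel (by omega)]
    omega
  · omega

theorem card_attachHook {N M : ℕ} {μ : YoungDiagram} (hμ : μ ∈ box N M) :
    (attachHook N M μ).card = μ.card + (M + 1 + N) := by
  have h1 : (attachHook N M μ).rowLen (N + 1) = 0 := by
    rw [rowLen_attachHook, hookRows, if_neg (by omega), if_neg (by omega)]
  have h2 : (attachHook N M μ).rowLen 0 = M + 1 := by
    rw [rowLen_attachHook, hookRows, if_pos rfl]
  rw [card_eq_sum_rowLen _ h1, card_eq_sum_rowLen _ hμ.1, Finset.sum_range_succ', h2,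
    Finset.sum_congr rfl (g := fun i => μ.rowLen i + 1), Finset.sum_add_distrib,
    Finset.sum_const, Finset.card_range, smul_eq_mul]
  · omega
  · intro i hi
    rw [Finset.mem_range] at hi
    have := μ.rowLen_anti 0 i (Nat.zero_le i)
    have := hμ.2
    rw [rowLen_attachHook, hookRows, if_neg (Nat.succ_ne_zero i), Nat.add_sub_cancel,
      if_pos (by omega)]
    omega

theorem colLen_attachHook (N M : ℕ) (μ : YoungDiagram) : (attachHook N M μ).colLen 0 = N + 1 := by
  refine colLen_eq_of_mem_iff fun i => ?_
  rw [YoungDiagram.mem_iff_lt_rowLen, rowLen_attachHook, hookRows]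
  split_ifs <;> omega

/-! ### Diagrams in a box with large `frobeniusMax` -/

/-- The diagrams with at most `N` rows and `M` columns for which `frobeniusMax` is at least `r`. -/
def frobeniusClass (r N M : ℕ) : Set YoungDiagram :=
  {μ | (r : ℤ) ≤ frobeniusMax μ N ∧ μ ∈ box N M}

/-- The diagrams with at most `N` rows and exactly `M + 1` columns for which the first hook is
followed by a diagram with `frobeniusMax` at least `r`. -/
def hookClass (r M N : ℕ) : Set YoungDiagram :=
  {μ | μ.rowLen N = 0 ∧ μ.rowLen 0 = M + 1 ∧ (r : ℤ) ≤ frobeniusMax (peel μ) (μ.colLen 0 - 1)}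

theorem genFun_hookClass_zero (r M : ℕ) : cellGenFun (hookClass r M 0) = 0 := by
  rw [show hookClass r M 0 = ∅ from ?_]
  · exact genFun_empty _
  ext μ
  simp only [hookClass, Set.mem_ofPred_eq, Set.mem_empty_iff_false, iff_false]
  omega

/-- The new diagrams are those with exactly `N + 1` rows. Their first hook has arm `M` and leg `N`;
removing it leaves any diagram of `frobeniusClass r N M`. -/
theorem genFun_hookClass_succ (r M N : ℕ) :
    cellGenFun (hookClass r M (N + 1)) =
      cellGenFun (hookClass r M N) + X ^ (M + 1 + N) * cellGenFun (frobeniusClass r N M) := by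
  rw [← genFun_eq_X_pow_mul (w := YoungDiagram.card)
    (S := {μ ∈ hookClass r M (N + 1) | μ.colLen 0 = N + 1}) (attachHook N M) ?_
    fun μ hμ => card_attachHook hμ.2]
  · refine genFun_union finite_card_eq ?_ ?_
    · refine Set.disjoint_left.2 fun μ h1 h2 => ?_
      have := colLen_zero_le_iff.2 h1.1
      have := h2.2
      omega
    · intro μ
      simp only [hookClass, Set.mem_ofPred_eq, ← colLen_zero_le_iff]
      constructor
      · rintro ⟨h1, h2⟩
        by_cases h : μ.colLen 0 ≤ N
        · exact Or.inl ⟨h, h2⟩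
        · exact Or.inr ⟨⟨h1, h2⟩, by omega⟩
      · rintro (⟨h1, h2⟩ | ⟨h1, -⟩)
        · exact ⟨by omega, h2⟩
        · exact h1
  · refine Set.InvOn.bijOn (f' := peel) ⟨fun μ hμ => peel_attachHook hμ.2,
      fun μ hμ => attachHook_peel hμ.1.2.1 hμ.2⟩ ?_ ?_
    · rintro μ ⟨h1, h2⟩
      refine ⟨⟨?_, ?_, ?_⟩, colLen_attachHook N M μ⟩
      · rw [← colLen_zero_le_iff, colLen_attachHook]
      · rw [rowLen_attachHook, hookRows, if_pos rfl]
      · rwa [peel_attachHook h2, colLen_attachHook, Nat.add_sub_cancel]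
    · rintro μ ⟨⟨h1, h2, h3⟩, h4⟩
      rw [h4, Nat.add_sub_cancel] at h3
      refine ⟨h3, ?_, ?_⟩
      · rw [rowLen_peel, h1]
      · have := μ.rowLen_anti 0 1 (Nat.zero_le 1)
        simp only [rowLen_peel, zero_add]
        omega

/-- When there are exactly `M + 1` columns, `h` makes the term `i = 0` too small, so the bound `r`
must be reached after the first hook. -/
theorem genFun_frobeniusClass_succ {r N M : ℕ} (h : N ≤ M + r) :
    cellGenFun (frobeniusClass r N (M + 1)) =
      cellGenFun (frobeniusClass r N M) + cellGenFun (hookClass r M N) := by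
  refine genFun_union finite_card_eq ?_ ?_
  · refine Set.disjoint_left.2 fun μ h1 h2 => ?_
    have := h1.2.2
    have := h2.2.1
    omega
  · intro μ
    have key : μ.rowLen 0 = M + 1 → ((r : ℤ) ≤ frobeniusMax μ N ↔
        (r : ℤ) ≤ frobeniusMax (peel μ) (μ.colLen 0 - 1)) := by
      intro h0
      rw [le_frobeniusMax_iff_peel, or_iff_right (by omega), and_iff_right (by omega)]
    simp only [hookClass, frobeniusClass, box, Set.mem_ofPred_eq]
    constructor
    · rintro ⟨h1, h2, h3⟩
      by_cases h4 : μ.rowLen 0 = M + 1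
      · exact Or.inr ⟨h2, h4, (key h4).1 h1⟩
      · exact Or.inl ⟨h1, h2, by omega⟩
    · rintro (⟨h1, h2, h3⟩ | ⟨h1, h2, h3⟩)
      · exact ⟨h1, h2, by omega⟩
      · exact ⟨(key h2).2 h3, h1, by omega⟩

theorem frobeniusClass_eq_box {r N M : ℕ} (h : r + M ≤ N) : frobeniusClass r N M = box N M := by
  ext μ
  simp only [frobeniusClass, Set.mem_ofPred_eq, and_iff_right_iff_imp]
  intro hμ
  have := hμ.2
  exact le_frobeniusMax_iff_peel.2 (Or.inl (by omega))

theorem frobeniusClass_eq_empty {r N : ℕ} (h : N < r) : frobeniusClass r N 0 = ∅ := by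
  ext μ
  simp only [frobeniusClass, Set.mem_ofPred_eq, Set.mem_empty_iff_false, iff_false]
  rintro ⟨h1, h2⟩
  rw [box_zero_right, Set.mem_singleton_iff] at h2
  rw [le_frobeniusMax_iff_peel, h2, rowLen_bot] at h1
  omega

/-- The number of diagrams in a box with `frobeniusMax` at least `r` is the number of all the
diagrams in another box. -/
theorem genFun_frobeniusClass (r M : ℕ) :
    (∀ N < r, cellGenFun (frobeniusClass r N M) = 0) ∧
      ∀ a ≤ M, cellGenFun (frobeniusClass r (r + a) M) = cellGenFun (box a (M + r)) := by
  induction M with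
  | zero =>
    refine ⟨fun N hN => by
      rw [frobeniusClass_eq_empty hN]
      exact genFun_empty _, fun a ha => ?_⟩
    obtain rfl : a = 0 := by omega
    rw [frobeniusClass_eq_box le_rfl, box_zero_left, box_zero_right]
  | succ M ih =>
    obtain ⟨ih1, ih2⟩ := ih
    -- Summing over the leg of the first hook: legs below `r` contribute nothing, and the others add
    -- up by one of the two Pascal recurrences. The other recurrence then carries out the step from
    -- `M` to `M + 1`.
    have hook1 : ∀ N ≤ r, cellGenFun (hookClass r M N) = 0 := by
      intro N
      induction N with
      | zero => exact fun _ => genFun_hookClass_zero r M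
      | succ N ihN =>
        intro hN
        rw [genFun_hookClass_succ, ihN (by omega), ih1 N (by omega), mul_zero, add_zero]
    have hook2 : ∀ a ≤ M, cellGenFun (hookClass r M (r + a + 1)) =
        X ^ (M + 1 + r) * cellGenFun (box a (M + 1 + r)) := by
      intro a
      induction a with
      | zero =>
        intro _
        rw [add_zero, genFun_hookClass_succ, hook1 _ le_rfl, zero_add]
        have := ih2 0 (Nat.zero_le M)
        rw [add_zero] at this
        rw [this, box_zero_left, box_zero_left]
      | succ a iha =>
        intro ha
        rw [genFun_hookClass_succ, ← add_assoc r a 1, iha (by omega), add_assoc r a 1,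
          ih2 (a + 1) ha, show M + 1 + r = M + r + 1 by ring, genFun_box_succ_succ' a (M + r)]
        ring
    refine ⟨fun N hN => ?_, fun a ha => ?_⟩
    · rw [genFun_frobeniusClass_succ (by omega), ih1 N hN, hook1 N hN.le, add_zero]
    · rcases Nat.lt_or_ge M a with h | h
      -- In this boundary case the term `i = 0` already reaches `r`, so the class is a full box, and
      -- the claim is the symmetry of the Gaussian binomial.
      · obtain rfl : a = M + 1 := by omega
        rw [frobeniusClass_eq_box le_rfl, genFun_box_comm, add_comm r]
      · rw [genFun_frobeniusClass_succ (by omega), ih2 a h]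
        rcases a with _ | a
        · rw [add_zero, hook1 _ le_rfl, box_zero_left, box_zero_left, add_zero]
        · rw [← add_assoc r a 1, hook2 a (by omega), show M + 1 + r = M + r + 1 by ring,
            genFun_box_succ_succ]

/-! ### The Durfee rectangle -/

theorem rectangle_subset_iff {μ : YoungDiagram} {a n : ℕ} :
    Finset.range n ×ˢ Finset.range (n + a) ⊆ μ.cells ↔ n = 0 ∨ n + a ≤ μ.rowLen (n - 1) := by
  constructor
  · intro h
    by_contra! hn
    have := @h (n - 1, n + a - 1) (by
      simp only [Finset.mem_product, Finset.mem_range]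
      omega)
    rw [YoungDiagram.mem_cells, YoungDiagram.mem_iff_lt_rowLen] at this
    omega
  · rintro h ⟨i, j⟩ hc
    simp only [Finset.mem_product, Finset.mem_range] at hc
    rw [YoungDiagram.mem_cells, YoungDiagram.mem_iff_lt_rowLen]
    have := μ.rowLen_anti i (n - 1) (by omega)
    omega

theorem durfeeSide_le (a : ℕ) (μ : YoungDiagram) : durfeeSide a μ ≤ μ.colLen 0 :=
  Nat.findGreatest_le _

/-- A rectangle fits iff its last row does, and by monotonicity only the sides `m` and `m + 1` need
testing. -/
theorem durfeeSide_eq_iff {a m : ℕ} {μ : YoungDiagram} :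
    durfeeSide a μ = m ↔ (m = 0 ∨ m + a ≤ μ.rowLen (m - 1)) ∧ μ.rowLen m ≤ m + a := by
  rw [durfeeSide, Nat.findGreatest_eq_iff]
  simp only [rectangle_subset_iff]
  constructor
  · rintro ⟨h1, h2, h3⟩
    refine ⟨?_, ?_⟩
    · by_cases h : m = 0
      · exact Or.inl h
      · exact h2 h
    · by_contra! h
      refine h3 (Nat.lt_succ_self m) ?_ (Or.inr ?_)
      · exact lt_rowLen_iff_lt_colLen.1 ((Nat.zero_le _).trans_lt h)
      · rw [Nat.succ_sub_one]
        omega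
  · rintro ⟨h1, h2⟩
    refine ⟨?_, fun _ => h1, fun n hn _ => ?_⟩
    · rcases h1 with h1 | h1
      · omega
      · have := lt_rowLen_iff_lt_colLen (μ := μ) (i := m - 1) (j := 0)
        omega
    · have := μ.rowLen_anti m (n - 1) (by omega)
      omega

theorem rowLen_rightPart (μ : YoungDiagram) (n c i : ℕ) :
    (rightPart μ n c).rowLen i = if i < n then μ.rowLen i - c else 0 := by
  refine rowLen_eq_of_mem_iff fun j => ?_
  rw [← YoungDiagram.mem_cells]
  simp only [rightPart, Finset.mem_image, Finset.mem_filter, YoungDiagram.mem_cells,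
    Prod.mk.injEq]
  constructor
  · rintro ⟨⟨i', j'⟩, ⟨h1, h2, h3⟩, rfl, rfl⟩
    rw [YoungDiagram.mem_iff_lt_rowLen] at h1
    simp only at h2 h3 ⊢
    rw [if_pos h2]
    omega
  · intro h
    split_ifs at h with hi
    · refine ⟨(i, j + c), ⟨?_, hi, ?_⟩, rfl, ?_⟩
      · rw [YoungDiagram.mem_iff_lt_rowLen]
        omega
      · simp
      · simp
    · omega

/-- The row lengths of the diagram made of a rectangle with `m` rows and `c` columns, a diagram
to the right of it and a diagram below it. -/
def glueRows (m c : ℕ) (A B : YoungDiagram) (i : ℕ) : ℕ :=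
  if i < m then A.rowLen i + c else min (B.rowLen (i - m)) c

theorem antitone_glueRows (m c : ℕ) (A B : YoungDiagram) : Antitone (glueRows m c A B) := by
  intro i j hij
  simp only [glueRows]
  have h1 := A.rowLen_anti i j hij
  have h2 := B.rowLen_anti (i - m) (j - m) (by omega)
  split_ifs <;> omega

/-- The diagram made of a rectangle with `m` rows and `c` columns, a diagram to the right of it
and a diagram below it. -/
def glue (m c : ℕ) (p : YoungDiagram × YoungDiagram) : YoungDiagram :=
  ofRows (glueRows m c p.1 p.2) (antitone_glueRows m c p.1 p.2) (m + p.2.colLen 0)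

theorem rowLen_glue (m c : ℕ) (p : YoungDiagram × YoungDiagram) (i : ℕ) :
    (glue m c p).rowLen i = glueRows m c p.1 p.2 i := by
  refine rowLen_ofRows _ ?_ i
  have : p.2.rowLen (p.2.colLen 0) = 0 := colLen_zero_le_iff.1 le_rfl
  rw [glueRows, if_neg (by omega), Nat.add_sub_cancel_left, this, Nat.zero_min]

theorem card_glue {m c : ℕ} {p : YoungDiagram × YoungDiagram} (h1 : p.1.rowLen m = 0)
    (h2 : p.2.rowLen 0 ≤ c) : (glue m c p).card = p.1.card + p.2.card + m * c := by
  have h3 : p.2.rowLen (p.2.colLen 0) = 0 := colLen_zero_le_iff.1 le_rfl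
  have h4 : (glue m c p).rowLen (m + p.2.colLen 0) = 0 := by
    rw [rowLen_glue, glueRows, if_neg (by omega), Nat.add_sub_cancel_left, h3, Nat.zero_min]
  rw [card_eq_sum_rowLen _ h4, card_eq_sum_rowLen _ h1, card_eq_sum_rowLen _ h3,
    Finset.sum_range_add, Finset.sum_congr rfl (g := fun i => p.1.rowLen i + c),
    Finset.sum_congr (s₁ := Finset.range (p.2.colLen 0)) rfl (g := fun i => p.2.rowLen i),
    Finset.sum_add_distrib, Finset.sum_const, Finset.card_range, smul_eq_mul]
  · omega
  · intro i _
    have := p.2.rowLen_anti 0 i (Nat.zero_le i)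
    rw [rowLen_glue, glueRows, if_neg (by omega), Nat.add_sub_cancel_left]
    omega
  · intro i hi
    rw [Finset.mem_range] at hi
    rw [rowLen_glue, glueRows, if_pos hi]

/-- The part of a diagram below the first `m` rows. -/
def bottomPart (μ : YoungDiagram) (m : ℕ) : YoungDiagram :=
  ofRows (fun i => μ.rowLen (m + i)) (fun i j hij => μ.rowLen_anti _ _ (by omega)) (μ.colLen 0)

theorem rowLen_bottomPart (μ : YoungDiagram) (m i : ℕ) :
    (bottomPart μ m).rowLen i = μ.rowLen (m + i) := by
  refine rowLen_ofRows (f := fun i => μ.rowLen (m + i)) _ ?_ i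
  have : μ.rowLen (m + μ.colLen 0) = 0 := colLen_zero_le_iff.1 (Nat.le_add_left _ _)
  exact this

theorem rightPart_glue {m c : ℕ} {p : YoungDiagram × YoungDiagram} (h1 : p.1.rowLen m = 0) :
    rightPart (glue m c p) m c = p.1 := by
  refine ext_rowLen fun i => ?_
  rw [rowLen_rightPart, rowLen_glue, glueRows]
  have : m ≤ i → p.1.rowLen i ≤ p.1.rowLen m := p.1.rowLen_anti m i
  split_ifs <;> omega

theorem bijOn_glue (a m : ℕ) (Q : Set YoungDiagram) :
    Set.BijOn (glue m (m + a)) ({A | A.rowLen m = 0 ∧ A ∈ Q} ×ˢ {B | B.rowLen 0 ≤ m + a})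
      {μ | durfeeSide a μ = m ∧ rightPart μ m (m + a) ∈ Q} := by
  refine Set.InvOn.bijOn (f' := fun μ => (rightPart μ m (m + a), bottomPart μ m))
    ⟨?_, ?_⟩ ?_ ?_
  · rintro p ⟨⟨h1, -⟩, h2⟩
    simp only [Set.mem_ofPred_eq] at h2
    refine Prod.ext (rightPart_glue h1) (ext_rowLen fun i => ?_)
    have := p.2.rowLen_anti 0 i (Nat.zero_le i)
    simp only [rowLen_bottomPart, rowLen_glue, glueRows]
    rw [if_neg (by omega), Nat.add_sub_cancel_left]
    omega
  · rintro μ ⟨h1, -⟩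
    rw [durfeeSide_eq_iff] at h1
    refine ext_rowLen fun i => ?_
    simp only [rowLen_glue, glueRows, rowLen_bottomPart, rowLen_rightPart]
    split_ifs with h
    · have := μ.rowLen_anti i (m - 1) (by omega)
      omega
    · have := μ.rowLen_anti m i (by omega)
      rw [Nat.add_sub_of_le (not_lt.1 h)]
      omega
  · rintro p ⟨⟨h1, h3⟩, h2⟩
    simp only [Set.mem_ofPred_eq] at h2
    refine ⟨durfeeSide_eq_iff.2 ⟨?_, ?_⟩, by rwa [rightPart_glue h1]⟩
    · rcases Nat.eq_zero_or_pos m with h | h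
      · exact Or.inl h
      · rw [rowLen_glue, glueRows, if_pos (by omega)]
        omega
    · rw [rowLen_glue, glueRows, if_neg (lt_irrefl m)]
      omega
  · rintro μ ⟨h1, h2⟩
    rw [durfeeSide_eq_iff] at h1
    refine ⟨⟨?_, h2⟩, ?_⟩
    · rw [rowLen_rightPart, if_neg (lt_irrefl m)]
    · simp only [Set.mem_ofPred_eq, rowLen_bottomPart, add_zero]
      exact h1.2

theorem genFun_columns_le (c : ℕ) : cellGenFun {B | B.rowLen 0 ≤ c} = cellGenFun (rowsLE c) := by
  refine genFun_eq_of_bijOn YoungDiagram.transpose ?_ fun μ _ => card_transpose μ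
  refine Set.InvOn.bijOn (f' := YoungDiagram.transpose)
    ⟨fun μ _ => μ.transpose_transpose, fun μ _ => μ.transpose_transpose⟩ ?_ ?_
  · intro μ hμ
    simp only [rowsLE, Set.mem_ofPred_eq, YoungDiagram.rowLen_transpose] at hμ ⊢
    exact colLen_zero_le_iff.2 hμ
  · intro μ hμ
    simp only [rowsLE, Set.mem_ofPred_eq] at hμ ⊢
    rwa [← colLen_zero_le_iff, YoungDiagram.colLen_transpose]

theorem genFun_durfeeSide (a m : ℕ) (Q : Set YoungDiagram) :
    cellGenFun {μ | durfeeSide a μ = m ∧ rightPart μ m (m + a) ∈ Q} =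
      X ^ (m * (m + a)) *
        (cellGenFun {A | A.rowLen m = 0 ∧ A ∈ Q} * cellGenFun (rowsLE (m + a))) := by
  rw [← genFun_columns_le, ← genFun_prod finite_card_eq finite_card_eq]
  exact genFun_eq_X_pow_mul _ (bijOn_glue a m Q) fun p hp => card_glue hp.1.1 hp.2

/-! ### The distribution of the statistic -/

/-- The diagrams with at most `m` rows whose residual diagram has `frobeniusMax` at least `r`. -/
def residualClass (r m : ℕ) : Set YoungDiagram :=
  {A | A.rowLen m = 0 ∧ residual (m + 1) A ∈ {R | (r : ℤ) ≤ frobeniusMax R m}}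

theorem genFun_residualClass_mul (r m : ℕ) :
    cellGenFun (residualClass r m) * qFactorial (m + 1 + m) =
      cellGenFun (frobeniusClass r m (m + 1)) * qFactorial (m + 1) := by
  have := genFun_residual_mul m (m + 1) {R | (r : ℤ) ≤ frobeniusMax R m}
  rw [← show frobeniusClass r m (m + 1) =
    {μ | μ ∈ {R | (r : ℤ) ≤ frobeniusMax R m} ∧ μ ∈ box m (m + 1)} from rfl] at this
  rw [qFactorial_add, residualClass]
  linear_combination qFactorial (m + 1) * this

theorem genFun_residualClass_of_lt {r m : ℕ} (h : m < r) :
    cellGenFun (residualClass r m) = 0 := by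
  have := genFun_residualClass_mul r m
  rw [(genFun_frobeniusClass r (m + 1)).1 m h, zero_mul] at this
  exact (mul_eq_zero.1 this).resolve_right (qFactorial_ne_zero _)

/-- With `m = r + a`, the residual class contributes the Gaussian binomial of the box `a` by `a + 2r
+ 1` times `(q)_{m+1} / (q)_{2m+1}`. Its numerator `(q)_{2m+1}` cancels, and `(q)_{m+1}` cancels
against `rowsLE (m + 1)`. -/
theorem genFun_residualClass_mul_rowsLE (r a : ℕ) :
    cellGenFun (residualClass r (r + a)) * cellGenFun (rowsLE (r + a + 1)) =
      cellGenFun (rowsLE a) * cellGenFun (rowsLE (a + (2 * r + 1))) := by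
  have h1 := genFun_residualClass_mul r (r + a)
  rw [(genFun_frobeniusClass r (r + a + 1)).2 a (by omega)] at h1
  have h2 := genFun_box_mul a (r + a + 1 + r)
  rw [show a + (r + a + 1 + r) = r + a + 1 + (r + a) by ring,
    show r + a + 1 + r = a + (2 * r + 1) by ring] at h2
  rw [show r + a + 1 + r = a + (2 * r + 1) by ring] at h1
  have h3 := genFun_rowsLE_mul (r + a + 1)
  have h4 := genFun_rowsLE_mul a
  have h5 := genFun_rowsLE_mul (a + (2 * r + 1))
  refine mul_right_cancel₀ (mul_ne_zero (qFactorial_ne_zero (r + a + 1 + (r + a)))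
    (mul_ne_zero (qFactorial_ne_zero a) (qFactorial_ne_zero (a + (2 * r + 1))))) ?_
  generalize cellGenFun (residualClass r (r + a)) = G at *
  generalize cellGenFun (rowsLE (r + a + 1)) = P1 at *
  generalize cellGenFun (rowsLE a) = P2 at *
  generalize cellGenFun (rowsLE (a + (2 * r + 1))) = P3 at *
  generalize cellGenFun (box a (a + (2 * r + 1))) = B at *
  generalize qFactorial (r + a + 1 + (r + a)) = F at *
  generalize qFactorial (r + a + 1) = F1 at *
  generalize qFactorial a = F2 at *
  generalize qFactorial (a + (2 * r + 1)) = F3 at *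
  linear_combination P1 * F2 * F3 * h1 + F1 * P1 * h2 + F * h3 - F * P3 * F3 * h4 - F * h5

theorem genFun_durfeeSide_rankStat (r m : ℕ) :
    cellGenFun {μ ∈ {μ | (r : ℤ) ≤ rankStat 1 μ} | durfeeSide 1 μ = m} =
      X ^ (m * (m + 1)) * (cellGenFun (residualClass r m) * cellGenFun (rowsLE (m + 1))) := by
  rw [show residualClass r m = {A | A.rowLen m = 0 ∧
    A ∈ {A | residual (m + 1) A ∈ {R | (r : ℤ) ≤ frobeniusMax R m}}} from rfl,
    ← genFun_durfeeSide]
  refine congrArg cellGenFun (Set.ext fun μ => ?_)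
  simp only [Set.mem_ofPred_eq, rankStat]
  constructor
  · rintro ⟨h1, rfl⟩
    exact ⟨rfl, h1⟩
  · rintro ⟨rfl, h1⟩
    exact ⟨h1, rfl⟩

/-- Rests on `(r + a)(r + a + 1) = r(r + 1) + a(a + 2r + 1)`, which turns rectangles of offset 1
into rectangles of offset `2r + 1`. -/
theorem genFun_durfeeSide_rankStat_add (r a : ℕ) :
    cellGenFun {μ ∈ {μ | (r : ℤ) ≤ rankStat 1 μ} | durfeeSide 1 μ = r + a} =
      X ^ (r * (r + 1)) * cellGenFun {μ ∈ Set.univ | durfeeSide (2 * r + 1) μ = a} := by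
  have h := genFun_durfeeSide (2 * r + 1) a Set.univ
  simp only [Set.mem_univ, and_true] at h
  simp only [Set.mem_univ, true_and]
  rw [h, genFun_durfeeSide_rankStat, genFun_residualClass_mul_rowsLE]
  simp only [rowsLE]
  ring

/-- The diagrams with `rankStat 1` at least `r` are as many as the diagrams with `r * (r + 1)`
cells less. -/
theorem genFun_le_rankStat (r : ℕ) :
    cellGenFun {μ | (r : ℤ) ≤ rankStat 1 μ} = X ^ (r * (r + 1)) * cellGenFun Set.univ := by
  ext n
  have hle : ∀ a (μ : YoungDiagram), durfeeSide a μ ≤ μ.card := fun a μ =>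
    (durfeeSide_le a μ).trans (colLen_le_card μ 0)
  -- The cutoff is split as `r + (n + 1)`: the first `r` Durfee sides contribute nothing, and the
  -- remaining ones are indexed by `a ≤ n`, enough to cover every side on the right as well.
  rw [coeff_genFun_eq_sum finite_card_eq _ (durfeeSide 1) (K := r + (n + 1))
    (fun μ _ h => by have := hle 1 μ; omega), Finset.sum_range_add, Finset.sum_eq_zero, zero_add]
  · simp only [genFun_durfeeSide_rankStat_add]
    simp only [coeff_X_pow_mul']
    split_ifs with h
    · rw [coeff_genFun_eq_sum finite_card_eq _ (durfeeSide (2 * r + 1)) (K := n + 1)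
        (fun μ _ h => by have := hle (2 * r + 1) μ; omega)]
    · simp
  · intro m hm
    refine (congrArg (coeff n) (genFun_durfeeSide_rankStat r m)).trans ?_
    rw [genFun_residualClass_of_lt (Finset.mem_range.1 hm), zero_mul, mul_zero, map_zero]

/-! ### Partitions as diagrams and as multisets -/

theorem rowLens_ferrers {n : ℕ} (p : n.Partition) :
    (ferrers p).rowLens = p.parts.sort (· ≥ ·) :=
  YoungDiagram.rowLens_ofRowLens_eq_self fun _ hx =>
    p.parts_pos ((Multiset.mem_sort (· ≥ ·)).1 hx)

theorem sum_rowLens (μ : YoungDiagram) : μ.rowLens.sum = μ.card := by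
  rw [card_eq_sum_rowLen μ (colLen_zero_le_iff.1 le_rfl)]
  simp [YoungDiagram.rowLens, Finset.sum, Multiset.range]

theorem card_ferrers {n : ℕ} (p : n.Partition) : (ferrers p).card = n := by
  rw [← sum_rowLens, rowLens_ferrers, ← Multiset.sum_coe, Multiset.sort_eq, p.parts_sum]

theorem ferrers_injective (n : ℕ) : Function.Injective (ferrers (n := n)) := by
  intro p q h
  refine Nat.Partition.ext ?_
  rw [← Multiset.sort_eq p.parts (· ≥ ·), ← Multiset.sort_eq q.parts (· ≥ ·), ← rowLens_ferrers,
    ← rowLens_ferrers, h]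

theorem exists_ferrers_eq {n : ℕ} {μ : YoungDiagram} (hμ : μ.card = n) :
    ∃ p : n.Partition, ferrers p = μ := by
  refine ⟨⟨μ.rowLens, fun hi => μ.pos_of_mem_rowLens _ hi, by
    rw [Multiset.sum_coe, sum_rowLens, hμ]⟩, ?_⟩
  refine YoungDiagram.equivListRowLens.injective (Subtype.ext ?_)
  refine (rowLens_ferrers _).trans ?_
  exact List.Perm.eq_of_pairwise' (Multiset.pairwise_sort _ _) μ.rowLens_sorted.pairwise
    (Multiset.coe_eq_coe.1 (Multiset.sort_eq _ _))

theorem card_partition_ferrers (n : ℕ) (P : YoungDiagram → Prop) :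
    (Nat.card {p : n.Partition // P (ferrers p)} : ℤ) = coeff n (cellGenFun {μ | P μ}) := by
  rw [coeff_genFun, ← Nat.card_coe_set_eq]
  refine congrArg _ (Nat.card_congr (Equiv.ofBijective
    (fun p => ⟨ferrers p.1, p.2, card_ferrers p.1⟩) ⟨?_, ?_⟩))
  · intro p q h
    exact Subtype.ext (ferrers_injective n (congrArg Subtype.val h))
  · rintro ⟨μ, h1, h2⟩
    obtain ⟨p, rfl⟩ := exists_ferrers_eq h2
    exact ⟨⟨p, h1⟩, rfl⟩

theorem card_partition_parts (n : ℕ) (P : Multiset ℕ → Prop) :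
    (Nat.card {p : n.Partition // P p.parts} : ℤ) =
      coeff n (genFun Multiset.sum {s : Multiset ℕ | (∀ i ∈ s, 0 < i) ∧ P s}) := by
  rw [coeff_genFun, ← Nat.card_coe_set_eq]
  refine congrArg _ (Nat.card_congr (Equiv.ofBijective
    (fun p => ⟨p.1.parts, ⟨fun _ hi => p.1.parts_pos hi, p.2⟩, p.1.parts_sum⟩) ⟨?_, ?_⟩))
  · intro p q h
    exact Subtype.ext (Nat.Partition.ext (congrArg Subtype.val h))
  · rintro ⟨s, ⟨h1, h2⟩, h3⟩
    exact ⟨⟨⟨s, fun hi => h1 _ hi, h3⟩, h2⟩, rfl⟩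

/-! ### The minimal excludant -/

/-- The multiset `{2, 4, …, 2k}`. -/
def evens (k : ℕ) : Multiset ℕ := (Multiset.range k).map fun i => 2 * (i + 1)

theorem sum_evens (k : ℕ) : (evens k).sum = k * (k + 1) := by
  induction k with
  | zero => rfl
  | succ k ih =>
    rw [evens, Multiset.range_succ, Multiset.map_cons, Multiset.sum_cons, ← evens, ih]
    ring

theorem evens_le_iff {k : ℕ} {s : Multiset ℕ} :
    evens k ≤ s ↔ ∀ i < k, 2 * (i + 1) ∈ s := by
  have hnodup : (evens k).Nodup :=
    (Multiset.nodup_range k).map fun i j h => by simpa using h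
  rw [Multiset.le_iff_subset hnodup, Multiset.subset_iff]
  simp [evens]

/-- Adding one copy of each of `2, 4, ..., 2k` is injective, with sum `k * (k + 1)`. The conjunct
`True` matches the shape of `card_partition_parts`. -/
theorem genFun_evens_le (k : ℕ) :
    genFun Multiset.sum {s : Multiset ℕ | (∀ i ∈ s, 0 < i) ∧ evens k ≤ s} =
      X ^ (k * (k + 1)) * genFun Multiset.sum {s : Multiset ℕ | (∀ i ∈ s, 0 < i) ∧ True} := by
  refine genFun_eq_X_pow_mul (fun s => s + evens k) ⟨?_, ?_, ?_⟩ fun s _ => ?_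
  · rintro s ⟨h, -⟩
    refine ⟨fun i hi => ?_, Multiset.le_add_left _ _⟩
    rcases Multiset.mem_add.1 hi with hi | hi
    · exact h i hi
    · obtain ⟨j, -, rfl⟩ := Multiset.mem_map.1 hi
      omega
  · exact fun s _ t _ h => add_right_cancel h
  · rintro s ⟨h1, h2⟩
    refine ⟨s - evens k, ⟨fun i hi => h1 i (Multiset.mem_of_le (Multiset.sub_le_self _ _) hi),
      trivial⟩, Multiset.sub_add_cancel h2⟩
  · rw [Multiset.sum_add, sum_evens]

theorem exists_two_mul_notMem {n : ℕ} (p : n.Partition) : ∃ t, 2 * (t + 1) ∉ p.parts :=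
  ⟨n, fun h => by
    have := p.le_of_mem_parts h
    omega⟩

/-- The number of initial positive even integers that are parts of the partition. -/
def evenRun {n : ℕ} (p : n.Partition) : ℕ := Nat.find (exists_two_mul_notMem p)

theorem le_evenRun_iff {n k : ℕ} {p : n.Partition} : k ≤ evenRun p ↔ evens k ≤ p.parts := by
  rw [evenRun, Nat.le_find_iff, evens_le_iff]
  simp only [not_not]

theorem mex_two_two {n : ℕ} (p : n.Partition) : mex 2 2 p = 2 * (evenRun p + 1) := by
  refine IsLeast.csInf_eq ⟨⟨by omega, ?_, Nat.find_spec (exists_two_mul_notMem p)⟩, ?_⟩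
  · unfold Nat.ModEq
    omega
  · rintro m ⟨h1, h2, h3⟩
    unfold Nat.ModEq at h2
    have h4 : 2 * (m / 2 - 1 + 1) = m := by omega
    have : evenRun p ≤ m / 2 - 1 := Nat.find_min' _ (by rwa [h4])
    omega

theorem mex_modEq_iff {n : ℕ} (p : n.Partition) :
    mex 2 2 p ≡ 2 [MOD 2 * 2] ↔ Even (evenRun p) := by
  rw [mex_two_two, Nat.even_iff]
  unfold Nat.ModEq
  omega

/-! ### Comparison of the two statistics -/

/-- The last term `i = d` suffices, since `x_{d+1} = -1` and `y_d ≥ 0`. -/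
theorem frobeniusMax_nonneg (μ : YoungDiagram) (n : ℕ) : 0 ≤ frobeniusMax μ n := by
  refine le_frobeniusMax_iff.2 ⟨diagLength μ, le_rfl, ?_⟩
  rw [frobeniusX, if_neg (by omega), frobeniusY]
  split_ifs with h
  · omega
  · have : diagLength μ - 1 < μ.colLen (diagLength μ - 1) :=
      YoungDiagram.mem_iff_lt_colLen.1 (diag_mem_iff.2 (by omega))
    omega

theorem rerank_nonneg {n : ℕ} (p : n.Partition) : 0 ≤ rerank p := frobeniusMax_nonneg _ _

/-- Two statistics with the same distribution of values take even values equally often. -/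
theorem card_even_eq {α : Type*} [Finite α] {f g : α → ℕ}
    (h : ∀ k, Nat.card {a // k ≤ f a} = Nat.card {a // k ≤ g a}) :
    Nat.card {a // Even (f a)} = Nat.card {a // Even (g a)} := by
  have hcard : ∀ (u : α → ℕ) (k : ℕ),
      Nat.card {a // k ≤ u a} = Nat.card {a // u a = k} + Nat.card {a // k + 1 ≤ u a} := by
    intro u k
    have : {a | k ≤ u a} = {a | u a = k} ∪ {a | k + 1 ≤ u a} := by
      ext a
      simp only [Set.mem_ofPred_eq, Set.mem_union]
      omega
    have hd : Disjoint {a | u a = k} {a | k + 1 ≤ u a} := by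
      refine Set.disjoint_left.2 fun a h1 h2 => ?_
      simp only [Set.mem_ofPred_eq] at h1 h2
      omega
    have := congrArg Set.ncard this
    rwa [Set.ncard_union_eq hd (Set.toFinite _) (Set.toFinite _)] at this
  -- Fibres are differences of consecutive tails, so they have equal size; matching them fibre by
  -- fibre gives a permutation carrying `f` to `g`.
  have hfib : ∀ k, Nonempty ({a // f a = k} ≃ {a // g a = k}) := by
    intro k
    refine Finite.card_eq.1 ?_
    have h1 := hcard f k
    have h2 := hcard g k
    rw [h k, h (k + 1)] at h1
    omega
  let e : α ≃ α := (Equiv.sigmaFiberEquiv f).symm.trans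
    ((Equiv.sigmaCongrRight fun k => (hfib k).some).trans (Equiv.sigmaFiberEquiv g))
  have he : ∀ a, g (e a) = f a := fun a => ((hfib (f a)).some ⟨a, rfl⟩).2
  exact Nat.card_congr (e.subtypeEquiv fun a => by rw [he])

/-- Both sides are the coefficient of `X ^ n` in `X ^ (k * (k + 1))` times the partition generating
function. `hall` identifies its two models, multisets of positive parts and diagrams. -/
theorem card_le_evenRun_eq (n k : ℕ) :
    Nat.card {p : n.Partition // k ≤ evenRun p} =
      Nat.card {p : n.Partition // (k : ℤ) ≤ rerank p} := by
  have hall : genFun Multiset.sum {s : Multiset ℕ | (∀ i ∈ s, 0 < i) ∧ True} =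
      cellGenFun Set.univ := by
    ext m
    rw [← card_partition_parts m fun _ => True]
    exact card_partition_ferrers m fun _ => True
  have h1 := card_partition_parts n fun s => evens k ≤ s
  have h2 := card_partition_ferrers n fun μ => (k : ℤ) ≤ rankStat 1 μ
  rw [genFun_evens_le, hall, ← genFun_le_rankStat, ← h2] at h1
  simp only [le_evenRun_iff]
  exact_mod_cast h1

end MexRerank

theorem corollary2 (n : ℕ) :
    MexRerank.mexCount 2 2 n =
      Nat.card {p : n.Partition // Even (MexRerank.rerank p)} := by
  -- Passing to `toNat` loses nothing, because the rerank is never negative.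
  have h := MexRerank.card_even_eq (α := n.Partition) (f := MexRerank.evenRun)
    (g := fun p => (MexRerank.rerank p).toNat) fun k => by
      rw [MexRerank.card_le_evenRun_eq]
      refine Nat.card_congr (Equiv.subtypeEquivRight fun p => ?_)
      have := MexRerank.rerank_nonneg p
      omega
  have hmex : MexRerank.mexCount 2 2 n =
      Nat.card {p : n.Partition // Even (MexRerank.evenRun p)} :=
    Nat.card_congr (Equiv.subtypeEquivRight MexRerank.mex_modEq_iff)
  rw [hmex, h]
  refine Nat.card_congr (Equiv.subtypeEquivRight fun p => ?_)
  rw [← Int.even_coe_nat, Int.toNat_of_nonneg (MexRerank.rerank_nonneg p)]
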